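/- Let $D\ge 3$ be an integer. A (possibly disconnected) graph $G$ of the rank-$D$ model with two symmetric tensors $T$ and $P$ and $K_{D+1}$ interaction is the following finite stranded graph. It has finitely many vertices, each of type $T$ or of type $P$. Every vertex has $D+1$ half-edges, and any two distinct half-edges of a vertex share exactly one strand passing through the vertex, called a corner, so that a vertex has $\binom{D+1}{2}$ corners and each half-edge carries $D$ strands. The edges match the half-edges of the $T$-vertices bijectively with the half-edges of the $P$-vertices (so the graph is bipartite; multiple edges are allowed), and along each edge the $D$ strands at one end are joined to the $D$ strands at the other end by an arbitrary bijection. In addition $G$ may contain finitely many ring components, a ring being an edge without vertices that closes onto itself, its $D$ strands being joined by an arbitrary permutation of $\{1,\dots,D\}$. $G$ has at least one connected component. The faces of $G$ are the closed curves formed by the strands; a ring has as many faces as its permutation has cycles, fixed points included. The length of a face is the number of corners through which it passes. With $V(G)$ and $F(G)$ denoting the numbers of vertices and faces, the degree of a connected graph $G$ is $$\omega(G)=D+\frac{D(D-1)}{4}\,V(G)-F(G),$$ and the degree of a disconnected graph is the sum of the degrees of its connected components. **Proposition.** Let $G$ be a connected graph with more than two vertices, and suppose that $G$ has a vertex at least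 $\binom{D-1}{2}$ of whose corners belong to faces of length two. Then there exists a (possibly disconnected) graph $G'$ with strictly fewer vertices than $G$ and $\omega(G')\le\omega(G)$. -/

import Mathlib

/-- The ends of strands at vertices of valency `D + 1` with vertex set `V`. The half-edges of a
vertex `v` are labelled by `Fin (D + 1)`; the half-edge `i` of `v` carries `D` strands, one for
every other half-edge `j` of `v`. The triple `(v, i, j)` is the end, on the half-edge `i` of `v`,
of the strand that passes through the vertex from `i` to `j`. -/
abbrev StrandEnd (D : ℕ) (V : Type) : Type :=
  {x : V × Fin (D + 1) × Fin (D + 1) // x.2.1 ≠ x.2.2}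

/-- The half-edge that carries a strand end. -/
def StrandEnd.halfEdge {D : ℕ} {V : Type} (x : StrandEnd D V) : V × Fin (D + 1) :=
  (x.1.1, x.1.2.1)

/-- The corners: pairs of distinct half-edges at a vertex. Each vertex has `(D + 1).choose 2`. -/
abbrev VertexCorner (D : ℕ) (V : Type) : Type :=
  V × {s : Sym2 (Fin (D + 1)) // ¬ s.IsDiag}

/-- The corner `{i, j}` of `v` to which the strand end `(v, i, j)` belongs. -/
def StrandEnd.corner {D : ℕ} {V : Type} (x : StrandEnd D V) : VertexCorner D V :=
  (x.1.1, ⟨s(x.1.2.1, x.1.2.2), fun h => x.2 (Sym2.mk_isDiag_iff.mp h)⟩)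

/-- Stranded Feynman graphs, possibly disconnected, of the rank `D` model with two symmetric
tensors `T` and `P` and complete-graph interaction. Every vertex has `D + 1` half-edges, any two of
which share one strand; edges join half-edges of `T`-vertices to half-edges of `P`-vertices; along
an edge the `D` strands are joined by an arbitrary bijection. In addition there are finitely many
rings: edges without vertices that close onto themselves, with an arbitrary permutation of their
`D` strands. -/
structure StrandedGraph (D : ℕ) where
  TVertex : Type
  PVertex : Type
  Ring : Type
  [finiteT : Finite TVertex]
  [finiteP : Finite PVertex]
  [finiteRing : Finite Ring]
  /-- the edges, as a bijection between the half-edges of the two kinds of vertices -/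
  edge : TVertex × Fin (D + 1) ≃ PVertex × Fin (D + 1)
  /-- the strands running along the edges -/
  strand : StrandEnd D TVertex ≃ StrandEnd D PVertex
  /-- the strands of a half-edge run along the edge of that half-edge -/
  strand_halfEdge : ∀ x, (strand x).halfEdge = edge x.halfEdge
  /-- how the strands of a ring close up -/
  ringPerm : Ring → Equiv.Perm (Fin D)

namespace StrandedGraph

attribute [instance] StrandedGraph.finiteT StrandedGraph.finiteP StrandedGraph.finiteRing

variable {D : ℕ} (G : StrandedGraph D)

/-- All vertices. -/
abbrev Vertex : Type := G.TVertex ⊕ G.PVertex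

/-- All corners. -/
abbrev Corner : Type := VertexCorner D G.Vertex

/-- The corner at the `T`-end of the strand `x`. -/
def cornerT (x : StrandEnd D G.TVertex) : G.Corner := (Sum.inl x.corner.1, x.corner.2)

/-- The corner at the `P`-end of the strand `x`. -/
def cornerP (x : StrandEnd D G.TVertex) : G.Corner :=
  (Sum.inr (G.strand x).corner.1, (G.strand x).corner.2)

/-- Two corners are consecutive if a strand running along an edge joins them. -/
def Consecutive (c c' : G.Corner) : Prop := ∃ x, c = G.cornerT x ∧ c' = G.cornerP x

/-- The faces that pass through corners: the classes of the equivalence relation generated by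
being consecutive, that is the closed curves formed by the strands. -/
abbrev CornerFace : Type := Quot G.Consecutive

/-- The faces of a ring: the cycles (fixed points included) of its permutation. -/
abbrev RingFace (r : G.Ring) : Type := Quotient (Equiv.Perm.SameCycle.setoid (G.ringPerm r))

/-- All faces. -/
abbrev Face : Type := G.CornerFace ⊕ (Σ r : G.Ring, G.RingFace r)

/-- The number of corners of a face. -/
noncomputable def length (φ : G.CornerFace) : ℕ :=
  Nat.card {c : G.Corner // (Quot.mk _ c : G.CornerFace) = φ}

/-- The number of corners of the vertex `v` that belong to faces of length two. -/
noncomputable def shortCorners (v : G.Vertex) : ℕ :=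
  Nat.card {c : G.Corner // c.1 = v ∧ G.length (Quot.mk _ c) = 2}

/-- The simple graph of adjacency between vertices. -/
def skeleton : SimpleGraph G.Vertex :=
  SimpleGraph.fromRel fun v w => ∃ h, v = Sum.inl h.1 ∧ w = Sum.inr (G.edge h).1

/-- The connected components; each ring is one. -/
abbrev Component : Type := G.skeleton.ConnectedComponent ⊕ G.Ring

/-- A graph is connected if it has exactly one connected component. -/
def IsConnected : Prop := Nat.card G.Component = 1

/-- The number of vertices. -/
noncomputable def numVertices : ℕ := Nat.card G.Vertex

/-- The component of a vertex. -/
def vertexComponent (v : G.Vertex) : G.Component := Sum.inl (G.skeleton.connectedComponentMk v)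

theorem vertexComponent_eq_of_consecutive (c c' : G.Corner) (h : G.Consecutive c c') :
    G.skeleton.connectedComponentMk c.1 = G.skeleton.connectedComponentMk c'.1 := by
  obtain ⟨x, rfl, rfl⟩ := h
  apply SimpleGraph.ConnectedComponent.sound
  apply SimpleGraph.Adj.reachable
  rw [skeleton, SimpleGraph.fromRel_adj]
  refine ⟨Sum.inl_ne_inr, Or.inl ⟨x.halfEdge, rfl, ?_⟩⟩
  rw [← G.strand_halfEdge x]
  rfl

/-- The component that contains a face. -/
def faceComponent : G.Face → G.Component :=
  Sum.map
    (Quot.lift (fun c => G.skeleton.connectedComponentMk c.1) G.vertexComponent_eq_of_consecutive)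
    Sigma.fst

/-- The degree of a connected component with `V` vertices and `F` faces:
`D + D (D - 1) / 4 * V - F`. -/
noncomputable def componentDegree (C : G.Component) : ℚ :=
  (D : ℚ) + (D : ℚ) * ((D : ℚ) - 1) / 4 * (Nat.card {v : G.Vertex // G.vertexComponent v = C} : ℚ)
    - (Nat.card {φ : G.Face // G.faceComponent φ = C} : ℚ)

/-- The degree of a graph: the sum of the degrees of its connected components (there are finitely
many). -/
noncomputable def degree : ℚ := ∑ᶠ C : G.Component, G.componentDegree C

end StrandedGraph

/-! Exchanging the two types of vertices, one may assume that the given vertex `v` is a `T`-vertex.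
The graph `G'` arises by contracting `v` with a neighbour `w`. Following the strands of one edge `e`
from `v` to `w` gives a bijection `σ` of their half-edges; `v`, `w` and the edges between them are
deleted, and the half-edge `i` of `v` is merged with `σ i` of `w`. Two vertices disappear, so the
vertex term of the degree drops by `D.choose 2`. It therefore suffices that `G'` is connected and
that at most `D.choose 2` faces are lost.

Face count (`card_cornerFace_le_card_contract`): contraction identifies each of the `D.choose 2 + D`
corners of `v` with its image under `σ` at `w`, and each identification merges at most two faces. If
all edges between `v` and `w` form faces of length two, a corner between two such edges needs no
identification, but its face may vanish. Among the other corners, `D` are free: those at `e` leading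
outside, and one for every further edge `k` to `w`. On the latter, the strands form a permutation,
so all but one of the identifications at `k` imply the last. This leaves a loss of at most `D.choose
2`.

Choice of `w`: the pairs of half-edges of `v` whose corner is not on a face of length two form a
graph with at most `2 * D - 1` edges (`longPairs`). It contains every pair of half-edges leading to
different neighbours, and `v` has at least two neighbours. Edge counts leave two cases. If there are
two neighbours, one of them has only short faces with `v`; contracting it leaves a single neighbour,
so connectedness is clear. If there are at least three, all but two half-edges `a`, `b` lead to one
neighbour, while `a` and `b` lead to two further ones by single edges.

In the second case, contraction along `a` or along `b` keeps the graph connected. Otherwise some set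
of vertices would be joined to the rest only by the remaining `D - 1` edges of `v`, all ending at
`P`-vertices of the set. Counting half-edges in a bipartite graph of valency `D + 1` makes `D + 1`
divide `D - 1`, which is absurd (`exists_edge_leaving`). -/

/-! ### Counting classes, permutations and sums -/

/-- Imposing one further relation identifies at most two classes. -/
theorem card_quot_le_card_quot_or_add_one {α : Type*} [Finite α] (r : α → α → Prop) (a b : α) :
    Nat.card (Quot r) ≤ Nat.card (Quot fun c d => r c d ∨ c = a ∧ d = b) + 1 := by
  classical
  -- The class of `a` is redirected to that of `b`; hence `h` is well defined and can miss only the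
  -- class of `a`, which `none` supplies in `k`.
  let h : Quot (fun c d => r c d ∨ c = a ∧ d = b) → Quot r :=
    Quot.lift (fun c => if Quot.mk r c = Quot.mk r a then Quot.mk r b else Quot.mk r c) (by
      rintro c d (hr | ⟨rfl, rfl⟩)
      · simp only [Quot.sound hr]
      · simp)
  let k : Option (Quot fun c d => r c d ∨ c = a ∧ d = b) → Quot r :=
    fun o => o.elim (Quot.mk r a) h
  have hk : Function.Surjective k := by
    intro x
    induction x using Quot.ind with | mk c => ?_
    by_cases hc : Quot.mk r c = Quot.mk r a
    · exact ⟨none, hc.symm⟩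
    · exact ⟨some (Quot.mk _ c), if_neg hc⟩
  simpa [Finite.card_option] using Nat.card_le_card_of_surjective k hk

/-- Imposing finitely many further relations lowers the number of classes by at most their
number. -/
theorem card_quot_le_card_quot_or_add_card {α κ : Type*} [Finite α] (r : α → α → Prop)
    (f g : κ → α) (S : Finset κ) :
    Nat.card (Quot r) ≤
      Nat.card (Quot fun c d => r c d ∨ ∃ k ∈ S, c = f k ∧ d = g k) + S.card := by
  classical
  induction S using Finset.induction_on with
  | empty => simp
  | insert k S hk ih =>
    have h := card_quot_le_card_quot_or_add_one
      (fun c d => r c d ∨ ∃ k ∈ S, c = f k ∧ d = g k) (f k) (g k)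
    have heq : (fun c d => (r c d ∨ ∃ k ∈ S, c = f k ∧ d = g k) ∨ c = f k ∧ d = g k) =
        fun c d => r c d ∨ ∃ l ∈ insert k S, c = f l ∧ d = g l := by
      ext c d
      rw [Finset.exists_mem_insert, or_assoc, or_comm (a := ∃ k ∈ S, c = f k ∧ d = g k)]
    rw [heq] at h
    rw [Finset.card_insert_of_notMem hk]
    omega

/-- A function that is constant along all steps but one of a permutation is constant along the
remaining step, too. -/
theorem apply_perm_eq_of_forall_ne {α β : Type*} [Finite α] (ρ : Equiv.Perm α) (f : α → β) (a : α)
    (h : ∀ x, x ≠ a → f (ρ x) = f x) : f (ρ a) = f a := by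
  classical
  have hex : ∃ n, (ρ ^ n) (ρ a) = a := by
    obtain ⟨n, hn⟩ : ∃ n, orderOf ρ = n + 1 := Nat.exists_eq_succ_of_ne_zero (orderOf_pos ρ).ne'
    refine ⟨n, ?_⟩
    rw [← Equiv.Perm.mul_apply, ← pow_succ, ← hn, pow_orderOf_eq_one, Equiv.Perm.one_apply]
  -- The orbit is followed from `ρ a` to its first return to `a`; by minimality no earlier step
  -- starts at `a`.
  have key : ∀ n ≤ Nat.find hex, f ((ρ ^ n) (ρ a)) = f (ρ a) := by
    intro n
    induction n with
    | zero => simp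
    | succ n ih =>
      intro hn
      rw [pow_succ', Equiv.Perm.mul_apply, h _ (Nat.find_min hex hn), ih (by omega)]
  rw [← key _ le_rfl, Nat.find_spec hex]

/-- If two of the summands are larger than a common lower bound, the sum is larger by two. -/
theorem Finset.card_mul_add_two_le_sum {ι : Type*} (A : Finset ι) (f : ι → ℕ) (c : ℕ)
    (hf : ∀ k ∈ A, c ≤ f k) {i j : ι} (hi : i ∈ A) (hj : j ∈ A) (hij : i ≠ j) (hfi : c < f i)
    (hfj : c < f j) : A.card * c + 2 ≤ ∑ k ∈ A, f k := by
  classical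
  calc A.card * c + 2
      = ∑ k ∈ A, (c + (if k = i then 1 else 0) + (if k = j then 1 else 0)) := by
        simp [Finset.sum_add_distrib, hi, hj]
    _ ≤ ∑ k ∈ A, f k := by
        refine Finset.sum_le_sum fun k hk => ?_
        have := hf k hk
        split_ifs with h1 h2 h2
        · exact absurd (h1.symm.trans h2) hij
        · subst h1; omega
        · subst h2; omega
        · omega

/-! ### Graphs with few edges containing a complete multipartite graph -/

namespace SimpleGraph

variable {ι α : Type*} [Fintype ι]

theorem card_filter_le_degree (H : SimpleGraph ι) (p : ι → Prop) [DecidablePred p] (i : ι)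
    [Fintype (H.neighborSet i)]
    (h : ∀ j, p j → H.Adj i j) : (Finset.univ.filter p).card ≤ H.degree i := by
  rw [← card_neighborFinset_eq_degree]
  refine Finset.card_le_card fun j hj => ?_
  rw [mem_neighborFinset]
  exact h j (Finset.mem_filter.mp hj).2

theorem card_filter_lt_degree (H : SimpleGraph ι) (p : ι → Prop) [DecidablePred p] (i j : ι)
    [Fintype (H.neighborSet i)]
    (h : ∀ j, p j → H.Adj i j) (hij : H.Adj i j) (hj : ¬ p j) :
    (Finset.univ.filter p).card < H.degree i := by
  rw [← card_neighborFinset_eq_degree]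
  refine Finset.card_lt_card ((Finset.ssubset_iff_of_subset fun k hk => ?_).mpr ⟨j, ?_, ?_⟩)
  · rw [mem_neighborFinset]
    exact h k (Finset.mem_filter.mp hk).2
  · simpa using hij
  · simpa using hj

open Classical in
/-- A graph on `D + 1` vertices with fewer than `2 * D` edges that contains a complete bipartite
graph with nonempty parts: one of the parts is independent. -/
theorem exists_independent_of_two_classes (H : SimpleGraph ι) {D : ℕ}
    (hι : Fintype.card ι = D + 1) (hE : H.edgeFinset.card < 2 * D) (ν : ι → α) {a b : α}
    (hab : a ≠ b) (hν : ∀ i j, ν i ≠ ν j → H.Adj i j) (hcov : ∀ k, ν k = a ∨ ν k = b) :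
    (∀ i j, ν i = a → ν j = a → ¬ H.Adj i j) ∨ (∀ i j, ν i = b → ν j = b → ¬ H.Adj i j) := by
  by_contra! hcon
  obtain ⟨⟨i, j, hi, hj, hij⟩, k, l, hk, hl, hkl⟩ := hcon
  set A := Finset.univ.filter (fun x => ν x = a) with hA
  set B := Finset.univ.filter (fun x => ν x = b) with hB
  have hdisj : Disjoint A B := by
    rw [Finset.disjoint_left]
    intro x hx hx'
    simp only [hA, hB, Finset.mem_filter, Finset.mem_univ, true_and] at hx hx'
    exact hab (hx.symm.trans hx')
  have hunion : A ∪ B = Finset.univ := by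
    ext x
    simpa [hA, hB] using hcov x
  have hcard : A.card + B.card = D + 1 := by
    rw [← Finset.card_union_of_disjoint hdisj, hunion, Finset.card_univ, hι]
  have hsum : ∑ x ∈ A, H.degree x + ∑ x ∈ B, H.degree x = 2 * H.edgeFinset.card := by
    rw [← Finset.sum_union hdisj, hunion, sum_degrees_eq_twice_card_edges]
  have hadjA : ∀ x, ν x = a → ∀ y, ν y = b → H.Adj x y := fun x hx y hy =>
    hν x y (by rw [hx, hy]; exact hab)
  have hadjB : ∀ x, ν x = b → ∀ y, ν y = a → H.Adj x y := fun x hx y hy => (hadjA y hy x hx).symm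
  have h1 := Finset.card_mul_add_two_le_sum A (fun x => H.degree x) B.card
    (fun x hx => card_filter_le_degree H _ x (hadjA x (by simpa [hA] using hx)))
    (i := i) (j := j) (by simpa [hA] using hi) (by simpa [hA] using hj) hij.ne
    (card_filter_lt_degree H _ i j (hadjA i hi) hij (by rw [hj]; exact hab))
    (card_filter_lt_degree H _ j i (hadjA j hj) hij.symm (by rw [hi]; exact hab))
  have h2 := Finset.card_mul_add_two_le_sum B (fun x => H.degree x) A.card
    (fun x hx => card_filter_le_degree H _ x (hadjB x (by simpa [hB] using hx)))
    (i := k) (j := l) (by simpa [hB] using hk) (by simpa [hB] using hl) hkl.ne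
    (card_filter_lt_degree H _ k l (hadjB k hk) hkl (by rw [hl]; exact hab.symm))
    (card_filter_lt_degree H _ l k (hadjB l hl) hkl.symm (by rw [hk]; exact hab.symm))
  have h3 : 1 < A.card := Finset.one_lt_card.mpr
    ⟨i, by simpa [hA] using hi, j, by simpa [hA] using hj, hij.ne⟩
  have h4 : 1 < B.card := Finset.one_lt_card.mpr
    ⟨k, by simpa [hB] using hk, l, by simpa [hB] using hl, hkl.ne⟩
  obtain ⟨x, hx⟩ := Nat.exists_eq_add_of_lt h3
  obtain ⟨y, hy⟩ := Nat.exists_eq_add_of_lt h4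
  -- With parts of sizes `x + 2` and `y + 2`, the degree sum is at least `2 * (x + 2) * (y + 2) + 4
  -- = 4 * D + 2 * x * y`, against fewer than `2 * D` edges.
  rw [hx, hy] at hcard h1 h2
  nlinarith [Nat.zero_le (x * y)]

open Classical in
/-- A graph on `D + 1` vertices with fewer than `2 * D` edges in which vertices of different colours
are adjacent, with at least three colours: all but two of the vertices have the same colour. -/
theorem exists_pair_of_three_classes (H : SimpleGraph ι) {D : ℕ}
    (hι : Fintype.card ι = D + 1) (hE : H.edgeFinset.card < 2 * D) (ν : ι → α)
    (hν : ∀ i j, ν i ≠ ν j → H.Adj i j) {p q r : ι} (hpq : ν p ≠ ν q) (hpr : ν p ≠ ν r)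
    (hqr : ν q ≠ ν r) :
    ∃ a b c, ν a ≠ ν b ∧ ν a ≠ ν c ∧ ν b ≠ ν c ∧ ∀ k, k ≠ a → k ≠ b → ν k = ν c := by
  set A := Finset.univ.filter (fun x => ν x = ν p) with hA
  set B := Finset.univ.filter (fun x => ν x = ν q) with hB
  set C := Finset.univ.filter (fun x => ν x ≠ ν p ∧ ν x ≠ ν q) with hC
  have hAB : Disjoint A B := by
    rw [Finset.disjoint_left]
    intro x hx hx'
    simp only [hA, hB, Finset.mem_filter, Finset.mem_univ, true_and] at hx hx'
    exact hpq (hx.symm.trans hx')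
  have hABC : Disjoint (A ∪ B) C := by
    rw [Finset.disjoint_left]
    intro x hx hx'
    simp only [hA, hB, hC, Finset.mem_union, Finset.mem_filter, Finset.mem_univ,
      true_and] at hx hx'
    tauto
  have hunion : A ∪ B ∪ C = Finset.univ := by
    ext x
    simp only [hA, hB, hC, Finset.mem_union, Finset.mem_filter, Finset.mem_univ, true_and, iff_true]
    tauto
  have hcard : A.card + B.card + C.card = D + 1 := by
    rw [← Finset.card_union_of_disjoint hAB, ← Finset.card_union_of_disjoint hABC, hunion,
      Finset.card_univ, hι]
  have hsum : ∑ x ∈ A, H.degree x + ∑ x ∈ B, H.degree x + ∑ x ∈ C, H.degree x =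
      2 * H.edgeFinset.card := by
    rw [← Finset.sum_union hAB, ← Finset.sum_union hABC, hunion, sum_degrees_eq_twice_card_edges]
  have hpart : ∀ x : α, (Finset.univ.filter fun k => ν k = x).card +
      (Finset.univ.filter fun k => ν k ≠ x).card = D + 1 := by
    intro x
    rw [Finset.card_filter_add_card_filter_not, Finset.card_univ, hι]
  have hdegA : ∀ x ∈ A, B.card + C.card ≤ H.degree x := by
    intro x hx
    have hx' : ν x = ν p := by simpa [hA] using hx
    have h1 := hpart (ν p)
    have h2 := card_filter_le_degree H (fun k => ν k ≠ ν p) x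
      fun y hy => hν x y (by rw [hx']; exact hy.symm)
    rw [← hA] at h1
    omega
  have hdegB : ∀ x ∈ B, A.card + C.card ≤ H.degree x := by
    intro x hx
    have hx' : ν x = ν q := by simpa [hB] using hx
    have h1 := hpart (ν q)
    have h2 := card_filter_le_degree H (fun k => ν k ≠ ν q) x
      fun y hy => hν x y (by rw [hx']; exact hy.symm)
    rw [← hB] at h1
    omega
  have hABcard : (Finset.univ.filter fun k => ν k = ν p ∨ ν k = ν q).card = A.card + B.card := by
    rw [Finset.filter_or, Finset.card_union_of_disjoint hAB]
  have hadjC : ∀ x ∈ C, ∀ y, ν y = ν p ∨ ν y = ν q → H.Adj x y := by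
    intro x hx y hy
    have hx' : ν x ≠ ν p ∧ ν x ≠ ν q := by simpa [hC] using hx
    refine hν x y fun h => ?_
    rw [← h] at hy
    tauto
  have hdegC : ∀ x ∈ C, A.card + B.card ≤ H.degree x := by
    intro x hx
    rw [← hABcard]
    exact card_filter_le_degree H _ x (hadjC x hx)
  have hsA : A.card * (B.card + C.card) ≤ ∑ x ∈ A, H.degree x := by
    simpa using Finset.card_nsmul_le_sum A (fun x => H.degree x) _ hdegA
  have hsB : B.card * (A.card + C.card) ≤ ∑ x ∈ B, H.degree x := by
    simpa using Finset.card_nsmul_le_sum B (fun x => H.degree x) _ hdegB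
  have hsC : C.card * (A.card + B.card) ≤ ∑ x ∈ C, H.degree x := by
    simpa using Finset.card_nsmul_le_sum C (fun x => H.degree x) _ hdegC
  obtain ⟨x, hx⟩ : ∃ x, A.card = x + 1 :=
    Nat.exists_eq_succ_of_ne_zero (Finset.card_ne_zero_of_mem (a := p) (by simp [hA]))
  obtain ⟨y, hy⟩ : ∃ y, B.card = y + 1 :=
    Nat.exists_eq_succ_of_ne_zero (Finset.card_ne_zero_of_mem (a := q) (by simp [hB]))
  obtain ⟨z, hz⟩ : ∃ z, C.card = z + 1 :=
    Nat.exists_eq_succ_of_ne_zero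
      (Finset.card_ne_zero_of_mem (a := r) (by simp [hC, hpr.symm, hqr.symm]))
  -- The complete tripartite graph on `A`, `B`, `C` already has `2 * D - 1 + x * y + x * z + y * z`
  -- edges; a second colour inside `C` would add at least one more.
  have hmono : ∀ k ∈ C, ν k = ν r := by
    intro k hk
    by_contra hne
    have hk' : ν k ≠ ν p ∧ ν k ≠ ν q := by simpa [hC] using hk
    have hr : r ∈ C := by simp [hC, hpr.symm, hqr.symm]
    have h1 := Finset.card_mul_add_two_le_sum C (fun x => H.degree x) _ hdegC hk hr
      (fun h => hne (by rw [h]))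
      (by
        rw [← hABcard]
        exact card_filter_lt_degree H _ k r (hadjC k hk) (hν k r hne) (by tauto))
      (by
        rw [← hABcard]
        exact card_filter_lt_degree H _ r k (hadjC r hr) (hν r k (Ne.symm hne)) (by tauto))
    rw [hx, hy, hz] at hcard h1
    rw [hx, hy, hz] at hsA
    rw [hx, hy, hz] at hsB
    nlinarith [Nat.zero_le (x * y), Nat.zero_le (x * z), Nat.zero_le (y * z)]
  have hcov : ∀ k, ν k = ν p ∨ ν k = ν q ∨ ν k = ν r := by
    intro k
    by_cases h1 : ν k = ν p
    · exact Or.inl h1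
    by_cases h2 : ν k = ν q
    · exact Or.inr (Or.inl h2)
    · exact Or.inr (Or.inr (hmono k (by simp [hC, h1, h2])))
  -- The same count is now tight, which forces at least two of the three classes to be singletons.
  have hprod : x * y + x * z + y * z = 0 := by
    rw [hx, hy, hz] at hcard hsA hsB hsC
    nlinarith
  have hfibre : ∀ (s : Finset ι) (c d : ι), s.card = 1 → c ∈ s → d ∈ s → c = d :=
    fun s c d hs hc hd => Finset.card_le_one.mp hs.le c hc d hd
  have hpA : p ∈ A := by simp [hA]
  have hqB : q ∈ B := by simp [hB]
  have hrC : r ∈ C := by simp [hC, hpr.symm, hqr.symm]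
  have hzero : (x = 0 ∧ y = 0) ∨ (x = 0 ∧ z = 0) ∨ (y = 0 ∧ z = 0) := by
    have h1 : x * y = 0 := by omega
    have h2 : x * z = 0 := by omega
    have h3 : y * z = 0 := by omega
    simp only [mul_eq_zero] at h1 h2 h3
    tauto
  rcases hzero with ⟨rfl, rfl⟩ | ⟨rfl, rfl⟩ | ⟨rfl, rfl⟩
  · refine ⟨p, q, r, hpq, hpr, hqr, fun k hkp hkq => ?_⟩
    rcases hcov k with h | h | h
    · exact absurd (hfibre A k p hx (by simpa [hA] using h) hpA) hkp
    · exact absurd (hfibre B k q hy (by simpa [hB] using h) hqB) hkq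
    · exact h
  · refine ⟨p, r, q, hpr, hpq, hqr.symm, fun k hkp hkr => ?_⟩
    rcases hcov k with h | h | h
    · exact absurd (hfibre A k p hx (by simpa [hA] using h) hpA) hkp
    · exact h
    · exact absurd (hfibre C k r hz (by simp [hC, h, hpr.symm, hqr.symm]) hrC) hkr
  · refine ⟨q, r, p, hqr, hpq.symm, hpr.symm, fun k hkq hkr => ?_⟩
    rcases hcov k with h | h | h
    · exact h
    · exact absurd (hfibre B k q hy (by simpa [hB] using h) hqB) hkq
    · exact absurd (hfibre C k r hz (by simp [hC, h, hpr.symm, hqr.symm]) hrC) hkr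

end SimpleGraph

/-! ### Bypassing parts of a bijection -/

/-- Two bijections `f : A ≃ B` and `g` from the part `q` of `B` to the part `p` of `A` (with inverse
`g'`) are composed to a bijection from the rest of `A` to the rest of `B`, if following `f`, `g`
and `f` never leads back to `q`. -/
noncomputable def Equiv.bypass {A B : Type*} (f : A ≃ B) (p : A → Prop) (q : B → Prop) (g : B → A)
    (g' : A → B) (hpg : ∀ b, q b → p (g b)) (hqg : ∀ a, p a → q (g' a))
    (hgg' : ∀ a, p a → g (g' a) = a) (hg'g : ∀ b, q b → g' (g b) = b)
    (h1 : ∀ a, ¬ p a → q (f a) → ¬ q (f (g (f a))))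
    (h2 : ∀ b, ¬ q b → p (f.symm b) → ¬ p (f.symm (g' (f.symm b)))) :
    {a // ¬ p a} ≃ {b // ¬ q b} := by
  classical
  exact
  { toFun a := if h : q (f a) then ⟨f (g (f a)), h1 a a.2 h⟩ else ⟨f a, h⟩
    invFun b := if h : p (f.symm b) then ⟨f.symm (g' (f.symm b)), h2 b b.2 h⟩ else ⟨f.symm b, h⟩
    left_inv a := by
      by_cases h : q (f a)
      · have := hpg _ h
        simp [h, this, hg'g]
      · have := a.2
        simp [h, this]
    right_inv b := by
      by_cases h : p (f.symm b)
      · have := hqg _ h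
        simp [h, this, hgg']
      · have := b.2
        simp [h, this] }

section

variable {A B : Type*} {f : A ≃ B} {p : A → Prop} {q : B → Prop} {g : B → A} {g' : A → B}
  {hpg : ∀ b, q b → p (g b)} {hqg : ∀ a, p a → q (g' a)} {hgg' : ∀ a, p a → g (g' a) = a}
  {hg'g : ∀ b, q b → g' (g b) = b} {h1 : ∀ a, ¬ p a → q (f a) → ¬ q (f (g (f a)))}
  {h2 : ∀ b, ¬ q b → p (f.symm b) → ¬ p (f.symm (g' (f.symm b)))}

theorem Equiv.bypass_of_not (a : {a // ¬ p a}) (h : ¬ q (f a)) :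
    (f.bypass p q g g' hpg hqg hgg' hg'g h1 h2 a : B) = f a := by
  simp [Equiv.bypass, h]

theorem Equiv.bypass_of (a : {a // ¬ p a}) (h : q (f a)) :
    (f.bypass p q g g' hpg hqg hgg' hg'g h1 h2 a : B) = f (g (f a)) := by
  simp [Equiv.bypass, h]

end

namespace StrandEnd

variable {D : ℕ} {V W : Type}

/-- The strand end at another vertex, with half-edges relabelled by `τ`. -/
def move (w : W) (τ : Equiv.Perm (Fin (D + 1))) (x : StrandEnd D V) : StrandEnd D W :=
  ⟨(w, τ x.1.2.1, τ x.1.2.2), fun h => x.2 (τ.injective h)⟩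

theorem move_vertex (w : W) (τ : Equiv.Perm (Fin (D + 1))) (x : StrandEnd D V) :
    (x.move w τ).1.1 = w :=
  rfl

theorem move_move (v : V) (w : W) (τ τ' : Equiv.Perm (Fin (D + 1))) (x : StrandEnd D V)
    (hx : x.1.1 = v) (hτ : ∀ i, τ' (τ i) = i) : (x.move w τ).move v τ' = x := by
  subst hx
  apply Subtype.ext
  simp [move, hτ]

/-- The strand ends at the vertices other than `v`. -/
def equivNe (v : V) : StrandEnd D {t : V // t ≠ v} ≃ {x : StrandEnd D V // ¬ x.1.1 = v} where
  toFun x := ⟨⟨(x.1.1, x.1.2), x.2⟩, x.1.1.2⟩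
  invFun x := ⟨(⟨x.1.1.1, x.2⟩, x.1.1.2), x.1.2⟩
  left_inv _ := rfl
  right_inv _ := rfl

end StrandEnd

/-- The half-edges at the vertices other than `v`. -/
def halfEdgeEquivNe {V K : Type} (v : V) : {t : V // t ≠ v} × K ≃ {x : V × K // ¬ x.1 = v} where
  toFun x := ⟨(x.1, x.2), x.1.2⟩
  invFun x := ⟨⟨x.1.1, x.2⟩, x.1.2⟩
  left_inv _ := rfl
  right_inv _ := rfl

/-! ### Contraction of two vertices -/

namespace StrandedGraph

variable {D : ℕ} (G : StrandedGraph D)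

theorem halfEdge_strand_symm (y : StrandEnd D G.PVertex) :
    (G.strand.symm y).halfEdge = G.edge.symm y.halfEdge := by
  rw [Equiv.eq_symm_apply, ← G.strand_halfEdge, Equiv.apply_symm_apply]

variable (v : G.TVertex) (w : G.PVertex) (σ : Equiv.Perm (Fin (D + 1)))

/-- Every edge between `v` and `w` joins a half-edge `i` to the half-edge `σ i`. -/
def Aligned : Prop := ∀ i, (G.edge (v, i)).1 = w → (G.edge (v, i)).2 = σ i

variable {G v w σ}

/-- One detour through `w` and `v` is enough: a second arrival at `w` would, by alignment, occur at
the half-edge already occupied by the edge of `a`. -/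
theorem Aligned.edge_ne (h : G.Aligned v w σ) (a : G.TVertex × Fin (D + 1)) (ha : ¬ a.1 = v)
    (haw : (G.edge a).1 = w) : ¬ (G.edge (v, σ.symm (G.edge a).2)).1 = w := by
  intro h1
  have h2 := h _ h1
  rw [Equiv.apply_symm_apply] at h2
  have h3 : G.edge (v, σ.symm (G.edge a).2) = G.edge a := Prod.ext (h1.trans haw.symm) h2
  exact ha (congrArg Prod.fst (G.edge.injective h3)).symm

theorem Aligned.edge_symm_ne (h : G.Aligned v w σ) (b : G.PVertex × Fin (D + 1))
    (hb : ¬ b.1 = w) (hbv : (G.edge.symm b).1 = v) :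
    ¬ (G.edge.symm (w, σ (G.edge.symm b).2)).1 = v := by
  intro h1
  have h2 : G.edge (v, (G.edge.symm (w, σ (G.edge.symm b).2)).2) = (w, σ (G.edge.symm b).2) := by
    rw [← Equiv.eq_symm_apply]
    exact Prod.ext h1.symm rfl
  have h3 := h _ (congrArg Prod.fst h2)
  rw [h2] at h3
  have h4 := σ.injective h3
  rw [← h4] at h2
  have h5 : (v, (G.edge.symm b).2) = G.edge.symm b := Prod.ext hbv.symm rfl
  rw [h5, Equiv.apply_symm_apply] at h2
  exact hb (by rw [h2])

/-- The edges of the contraction. -/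
noncomputable def contractEdge (h : G.Aligned v w σ) :
    {a : G.TVertex × Fin (D + 1) // ¬ a.1 = v} ≃ {b : G.PVertex × Fin (D + 1) // ¬ b.1 = w} :=
  G.edge.bypass (fun a => a.1 = v) (fun b => b.1 = w) (fun b => (v, σ.symm b.2))
    (fun a => (w, σ a.2)) (fun _ _ => rfl) (fun _ _ => rfl)
    (fun _ ha => Prod.ext ha.symm (σ.symm_apply_apply _))
    (fun _ hb => Prod.ext hb.symm (σ.apply_symm_apply _))
    h.edge_ne h.edge_symm_ne

theorem contractEdge_of_ne (h : G.Aligned v w σ) (a : {a : G.TVertex × Fin (D + 1) // ¬ a.1 = v})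
    (ha : ¬ (G.edge a).1 = w) : (contractEdge h a : G.PVertex × Fin (D + 1)) = G.edge a := by
  rw [contractEdge, Equiv.bypass_of_not a ha]

theorem contractEdge_of_eq (h : G.Aligned v w σ) (a : {a : G.TVertex × Fin (D + 1) // ¬ a.1 = v})
    (ha : (G.edge a).1 = w) :
    (contractEdge h a : G.PVertex × Fin (D + 1)) = G.edge (v, σ.symm (G.edge a).2) := by
  rw [contractEdge, Equiv.bypass_of a ha]

theorem halfEdge_strand_move (a : StrandEnd D G.TVertex) :
    (G.strand ((G.strand a).move v σ.symm)).halfEdge =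
      G.edge (v, σ.symm (G.edge a.halfEdge).2) := by
  rw [G.strand_halfEdge, ← G.strand_halfEdge a]
  rfl

theorem halfEdge_strand_symm_move (b : StrandEnd D G.PVertex) :
    (G.strand.symm ((G.strand.symm b).move w σ)).halfEdge =
      G.edge.symm (w, σ (G.edge.symm b.halfEdge).2) := by
  rw [G.halfEdge_strand_symm, ← G.halfEdge_strand_symm b]
  rfl

theorem Aligned.strand_ne (h : G.Aligned v w σ) (a : StrandEnd D G.TVertex) (ha : ¬ a.1.1 = v)
    (haw : (G.strand a).1.1 = w) : ¬ (G.strand ((G.strand a).move v σ.symm)).1.1 = w := by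
  intro hc
  refine h.edge_ne a.halfEdge ha ?_ ?_
  · rw [← G.strand_halfEdge]
    exact haw
  · rw [← halfEdge_strand_move]
    exact hc

theorem Aligned.strand_symm_ne (h : G.Aligned v w σ) (b : StrandEnd D G.PVertex)
    (hb : ¬ b.1.1 = w) (hbv : (G.strand.symm b).1.1 = v) :
    ¬ (G.strand.symm ((G.strand.symm b).move w σ)).1.1 = v := by
  intro hc
  refine h.edge_symm_ne b.halfEdge hb ?_ ?_
  · rw [← G.halfEdge_strand_symm]
    exact hbv
  · rw [← halfEdge_strand_symm_move]
    exact hc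

/-- The strands along the edges of the contraction. -/
noncomputable def contractStrand (h : G.Aligned v w σ) :
    {x : StrandEnd D G.TVertex // ¬ x.1.1 = v} ≃ {y : StrandEnd D G.PVertex // ¬ y.1.1 = w} :=
  G.strand.bypass (fun a => a.1.1 = v) (fun b => b.1.1 = w) (StrandEnd.move v σ.symm)
    (StrandEnd.move w σ) (fun b _ => b.move_vertex v _) (fun a _ => a.move_vertex w _)
    (fun a ha => a.move_move v w _ _ ha σ.symm_apply_apply)
    (fun b hb => b.move_move w v _ _ hb σ.apply_symm_apply)
    h.strand_ne h.strand_symm_ne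

theorem contractStrand_of_ne (h : G.Aligned v w σ) (x : {x : StrandEnd D G.TVertex // ¬ x.1.1 = v})
    (hx : ¬ (G.strand x).1.1 = w) :
    (contractStrand h x : StrandEnd D G.PVertex) = G.strand x := by
  rw [contractStrand, Equiv.bypass_of_not x hx]

theorem contractStrand_of_eq (h : G.Aligned v w σ) (x : {x : StrandEnd D G.TVertex // ¬ x.1.1 = v})
    (hx : (G.strand x).1.1 = w) :
    (contractStrand h x : StrandEnd D G.PVertex) =
      G.strand ((G.strand x).move v σ.symm) := by
  rw [contractStrand, Equiv.bypass_of x hx]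

theorem halfEdge_contractStrand (h : G.Aligned v w σ)
    (x : {x : StrandEnd D G.TVertex // ¬ x.1.1 = v}) :
    (contractStrand h x : StrandEnd D G.PVertex).halfEdge =
      contractEdge h ⟨x.1.halfEdge, x.2⟩ := by
  have h1 : (G.strand x).1.1 = (G.edge x.1.halfEdge).1 :=
    congrArg Prod.fst (G.strand_halfEdge x)
  by_cases hw : (G.strand x).1.1 = w
  · rw [contractStrand_of_eq h x hw, contractEdge_of_eq h _ (h1.symm.trans hw),
      halfEdge_strand_move]
  · rw [contractStrand_of_ne h x hw, contractEdge_of_ne h _ fun hc => hw (h1.trans hc),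
      G.strand_halfEdge]

/-- Contraction of the vertices `v` and `w`: they are removed together with the edges between them,
and the other half-edges `i` of `v` are merged with the half-edges `σ i` of `w`. -/
noncomputable def contract (h : G.Aligned v w σ) : StrandedGraph D where
  TVertex := {t : G.TVertex // t ≠ v}
  PVertex := {p : G.PVertex // p ≠ w}
  -- Merging would close every edge between `v` and `w` onto itself; these loops are dropped and not
  -- kept as rings. Rings of `G` are dropped too, but a connected graph with a vertex has none.
  Ring := Empty
  edge := ((halfEdgeEquivNe v).trans (contractEdge h)).trans (halfEdgeEquivNe w).symm
  strand := ((StrandEnd.equivNe v).trans (contractStrand h)).trans (StrandEnd.equivNe w).symm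
  strand_halfEdge x := by
    have key : ∀ (y : {y : StrandEnd D G.PVertex // ¬ y.1.1 = w})
        (b : {b : G.PVertex × Fin (D + 1) // ¬ b.1 = w}), y.1.halfEdge = b.1 →
        ((StrandEnd.equivNe w).symm y).halfEdge = (halfEdgeEquivNe w).symm b := by
      rintro y ⟨_, hb⟩ rfl
      rfl
    exact key _ _ (halfEdge_contractStrand h (StrandEnd.equivNe v x))
  ringPerm r := r.elim

/-- The vertices of the contraction are vertices of the graph. -/
def contractIncl (h : G.Aligned v w σ) : (contract h).Vertex → G.Vertex :=
  Sum.map Subtype.val Subtype.val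

theorem numVertices_contract (h : G.Aligned v w σ) :
    (contract h).numVertices + 2 = G.numVertices := by
  classical
  have hT : Nat.card {t : G.TVertex // t ≠ v} + 1 = Nat.card G.TVertex := by
    have := Fintype.ofFinite G.TVertex
    rw [Nat.card_eq_fintype_card, Nat.card_eq_fintype_card, Fintype.card_subtype_compl,
      Fintype.card_subtype_eq]
    have : 0 < Fintype.card G.TVertex := Fintype.card_pos_iff.mpr ⟨v⟩
    omega
  have hP : Nat.card {p : G.PVertex // p ≠ w} + 1 = Nat.card G.PVertex := by
    have := Fintype.ofFinite G.PVertex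
    rw [Nat.card_eq_fintype_card, Nat.card_eq_fintype_card, Fintype.card_subtype_compl,
      Fintype.card_subtype_eq]
    have : 0 < Fintype.card G.PVertex := Fintype.card_pos_iff.mpr ⟨w⟩
    omega
  change Nat.card ({t : G.TVertex // t ≠ v} ⊕ {p : G.PVertex // p ≠ w}) + 2 =
    Nat.card (G.TVertex ⊕ G.PVertex)
  rw [Nat.card_sum, Nat.card_sum]
  omega

end StrandedGraph

/-! ### Pairs of half-edges -/

/-- The unordered pair of two distinct elements. -/
def offDiagPair {ι : Type*} (i j : ι) (h : i ≠ j) : {s : Sym2 ι // ¬ s.IsDiag} :=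
  ⟨s(i, j), fun hd => h (Sym2.mk_isDiag_iff.mp hd)⟩

/-- The action of a permutation on the unordered pairs of distinct elements. -/
def offDiagMap {ι : Type*} (σ : Equiv.Perm ι) (s : {s : Sym2 ι // ¬ s.IsDiag}) :
    {s : Sym2 ι // ¬ s.IsDiag} :=
  ⟨s.1.map σ, fun hd => s.2 ((Sym2.isDiag_map σ.injective).mp hd)⟩

theorem offDiagPair_comm {ι : Type*} (i j : ι) (h : i ≠ j) :
    offDiagPair i j h = offDiagPair j i h.symm :=
  Subtype.ext Sym2.eq_swap

theorem exists_eq_offDiagPair {ι : Type*} (s : {s : Sym2 ι // ¬ s.IsDiag}) :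
    ∃ i j h, s = offDiagPair i j h := by
  obtain ⟨s, hs⟩ := s
  induction s with | _ i j => exact ⟨i, j, fun h => hs (Sym2.mk_isDiag_iff.mpr h), rfl⟩

theorem card_offDiagPairs (D : ℕ) :
    Fintype.card {s : Sym2 (Fin (D + 1)) // ¬ s.IsDiag} = D.choose 2 + D := by
  rw [Sym2.card_subtype_not_diag, Fintype.card_fin, Nat.choose_succ_succ', Nat.choose_one_right,
    add_comm]

/-! ### Faces lost in a contraction -/

namespace StrandedGraph

variable {D : ℕ} {G : StrandedGraph D} {v : G.TVertex} {w : G.PVertex}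
  {σ : Equiv.Perm (Fin (D + 1))}

open Classical in
/-- Contraction along an edge `e` of `v` and `w` such that the strands of `e` and the faces formed
by the edges between `v` and `w` follow `σ`: at most `D.choose 2` faces are lost. -/
theorem card_cornerFace_le_card_contract (h : G.Aligned v w σ) {e j₀ : Fin (D + 1)}
    (he : (G.edge (v, e)).1 = w) (hj₀ : (G.edge (v, j₀)).1 ≠ w)
    (hstrand : ∀ x : StrandEnd D G.TVertex, x.1.1 = v → x.1.2.1 = e →
      G.strand x = x.move w σ)
    (hshort : ∀ x : StrandEnd D G.TVertex, x.1.1 = v → (G.edge (v, x.1.2.1)).1 = w →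
      (G.edge (v, x.1.2.2)).1 = w → G.strand x = x.move w σ) :
    Nat.card G.CornerFace ≤ Nat.card (contract h).CornerFace + D.choose 2 := by
  -- These are the `D` corners whose identification comes for free: `{e, k}` for `k` leading away
  -- from `w`, and one corner `{k, j₀}` for each further `k` leading to `w`.
  let φ : {k : Fin (D + 1) // k ≠ e} → {s : Sym2 (Fin (D + 1)) // ¬ s.IsDiag} := fun k =>
    if hk : (G.edge (v, k)).1 = w then offDiagPair k.1 j₀ (by rintro rfl; exact hj₀ hk)
    else offDiagPair e k k.2.symm
  have hφ : Function.Injective φ := by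
    rintro ⟨k, hk⟩ ⟨l, hl⟩ hkl
    have hej : e ≠ j₀ := by rintro rfl; exact hj₀ he
    simp only [φ] at hkl
    split_ifs at hkl with h1 h2 h2
    · have := congrArg Subtype.val hkl
      simp only [offDiagPair, Sym2.eq_iff] at this
      rcases this with ⟨h3, -⟩ | ⟨h3, h4⟩
      · exact Subtype.ext h3
      · exact Subtype.ext (h3.trans h4)
    · have := congrArg Subtype.val hkl
      simp only [offDiagPair, Sym2.eq_iff] at this
      rcases this with ⟨h3, -⟩ | ⟨-, h4⟩
      · exact absurd h3 hk
      · exact absurd h4.symm hej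
    · have := congrArg Subtype.val hkl
      simp only [offDiagPair, Sym2.eq_iff] at this
      rcases this with ⟨h3, -⟩ | ⟨h4, -⟩
      · exact absurd h3.symm hl
      · exact absurd h4 hej
    · have := congrArg Subtype.val hkl
      simp only [offDiagPair, Sym2.eq_iff] at this
      rcases this with ⟨-, h3⟩ | ⟨h3, h4⟩
      · exact Subtype.ext h3
      · exact Subtype.ext (h4.trans h3)
  let inside : {s : Sym2 (Fin (D + 1)) // ¬ s.IsDiag} → Prop :=
    fun s => ∀ i ∈ s.1, (G.edge (v, i)).1 = w
  let K : Finset {s : Sym2 (Fin (D + 1)) // ¬ s.IsDiag} :=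
    Finset.univ.filter fun s => ¬ inside s ∧ s ∉ Finset.univ.image φ
  let r : G.Corner → G.Corner → Prop := fun c d => G.Consecutive c d ∨
    ∃ s ∈ K, c = (Sum.inl v, s) ∧ d = (Sum.inr w, offDiagMap σ s)
  have hcons : ∀ x, Quot.mk r (G.cornerT x) = Quot.mk r (G.cornerP x) :=
    fun x => Quot.sound (Or.inl ⟨x, rfl, rfl⟩)
  have hmove : ∀ x : StrandEnd D G.TVertex, x.1.1 = v → G.strand x = x.move w σ →
      Quot.mk r (Sum.inl v, x.corner.2) = Quot.mk r (Sum.inr w, offDiagMap σ x.corner.2) := by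
    rintro x rfl hx
    refine (hcons x).trans ?_
    rw [cornerP, hx]
    rfl
  -- the identifications that are left out of `K` are consequences of the others
  have hpair : ∀ i j (hij : i ≠ j), (G.edge (v, i)).1 = w →
      (i ≠ e → j = j₀ → ∀ k (hik : i ≠ k), k ≠ j₀ → Quot.mk r (Sum.inl v, offDiagPair i k hik) =
        Quot.mk r (Sum.inr w, offDiagMap σ (offDiagPair i k hik))) →
      (i = e ∨ j = j₀ ∨ (G.edge (v, j)).1 = w) →
      Quot.mk r (Sum.inl v, offDiagPair i j hij) =
        Quot.mk r (Sum.inr w, offDiagMap σ (offDiagPair i j hij)) := by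
    intro i j hij hi hrec hcase
    by_cases hie : i = e
    · exact hmove ⟨(v, i, j), hij⟩ rfl (hstrand _ rfl hie)
    by_cases hj : (G.edge (v, j)).1 = w
    · exact hmove ⟨(v, i, j), hij⟩ rfl (hshort _ rfl hi hj)
    obtain rfl : j = j₀ := by tauto
    have hhalf : ∀ k (hik : i ≠ k), (G.strand ⟨(v, i, k), hik⟩).halfEdge = (w, σ i) := by
      intro k hik
      rw [G.strand_halfEdge]
      exact Prod.ext hi (h i hi)
    have hne : ∀ k (hik : i ≠ k), σ.symm (G.strand ⟨(v, i, k), hik⟩).1.2.2 ≠ i := by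
      intro k hik hc
      rw [Equiv.symm_apply_eq] at hc
      exact (G.strand ⟨(v, i, k), hik⟩).2
        ((congrArg Prod.snd (hhalf k hik) : _ = σ i).trans hc.symm)
    let ρ₀ : {k // k ≠ i} → {k // k ≠ i} :=
      fun k => ⟨σ.symm (G.strand ⟨(v, i, k), k.2.symm⟩).1.2.2, hne k k.2.symm⟩
    have hρ₀ : Function.Injective ρ₀ := by
      intro k l hkl
      have h1 := σ.symm.injective (congrArg Subtype.val hkl)
      have h2 : G.strand ⟨(v, i, k), k.2.symm⟩ = G.strand ⟨(v, i, l), l.2.symm⟩ := by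
        have h3 := (hhalf k k.2.symm).trans (hhalf l l.2.symm).symm
        exact Subtype.ext (Prod.ext (congrArg Prod.fst h3 :)
          (Prod.ext (congrArg Prod.snd h3 :) h1))
      have h4 := congrArg Subtype.val (G.strand.injective h2)
      exact Subtype.ext (congrArg (fun y => y.2.2) h4 :)
    -- Going along the strands of the edge `i` and back by `σ` permutes the other half-edges of `v`.
    -- By `hf` the class of `{i, k}` is `f (ρ k)`, so its identification with the `σ`-image reads `f
    -- (ρ k) = f k`; if this holds for all `k` but `j₀`, it holds for `j₀`.
    let ρ : Equiv.Perm {k // k ≠ i} := Equiv.ofBijective ρ₀ hρ₀.bijective_of_finite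
    let f : {k // k ≠ i} → Quot r :=
      fun k => Quot.mk r (Sum.inr w, offDiagMap σ (offDiagPair i k k.2.symm))
    have hf : ∀ k : {k // k ≠ i}, Quot.mk r (Sum.inl v, offDiagPair i k k.2.symm) = f (ρ k) := by
      intro k
      refine (hcons ⟨(v, i, k), k.2.symm⟩).trans (congrArg _ ?_)
      have h1 := hhalf k k.2.symm
      refine Prod.ext (congrArg Sum.inr (congrArg Prod.fst h1)) (Subtype.ext ?_)
      change s((G.strand ⟨(v, i, k), k.2.symm⟩).halfEdge.2, (G.strand ⟨(v, i, k), k.2.symm⟩).1.2.2) =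
        s(σ i, σ (σ.symm (G.strand ⟨(v, i, k), k.2.symm⟩).1.2.2))
      rw [h1, Equiv.apply_symm_apply]
    have := apply_perm_eq_of_forall_ne ρ f ⟨j, hij.symm⟩ fun k hk =>
      (hf k).symm.trans (hrec hie rfl k k.2.symm fun hc => hk (Subtype.ext hc))
    exact (hf ⟨j, hij.symm⟩).trans this
  have hK : ∀ s ∈ K, Quot.mk r (Sum.inl v, s) = Quot.mk r (Sum.inr w, offDiagMap σ s) :=
    fun s hs => Quot.sound (Or.inr ⟨s, hs, rfl, rfl⟩)
  -- First every corner except the `{i, j₀}` with `i ≠ e`, by strands or by membership in `K`; these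
  -- supply the hypothesis of the permutation argument in `hpair`.
  have hpair' : ∀ i j (hij : i ≠ j), (G.edge (v, i)).1 = w → (i = e ∨ j ≠ j₀) →
      Quot.mk r (Sum.inl v, offDiagPair i j hij) =
        Quot.mk r (Sum.inr w, offDiagMap σ (offDiagPair i j hij)) := by
    intro i j hij hi hcase
    by_cases hie : i = e
    · exact hpair i j hij hi (fun hc => absurd hie hc) (Or.inl hie)
    have hjj : j ≠ j₀ := by tauto
    by_cases hj : (G.edge (v, j)).1 = w
    · exact hpair i j hij hi (fun _ hc => absurd hc hjj) (Or.inr (Or.inr hj))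
    refine hK _ (Finset.mem_filter.mpr ⟨Finset.mem_univ _, fun hins => ?_, fun him => ?_⟩)
    · exact hj (hins j (Sym2.mem_mk_right i j))
    · obtain ⟨⟨k, hk⟩, -, hks⟩ := Finset.mem_image.mp him
      simp only [φ] at hks
      split_ifs at hks with h1
      · have := congrArg Subtype.val hks
        simp only [offDiagPair, Sym2.eq_iff] at this
        rcases this with ⟨-, h2⟩ | ⟨-, h2⟩
        · exact hjj h2.symm
        · exact hj₀ (h2 ▸ hi)
      · have := congrArg Subtype.val hks
        simp only [offDiagPair, Sym2.eq_iff] at this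
        rcases this with ⟨h2, -⟩ | ⟨h2, -⟩
        · exact hie h2.symm
        · exact hj (h2 ▸ he)
  have hpair'' : ∀ i j (hij : i ≠ j), (G.edge (v, i)).1 = w →
      Quot.mk r (Sum.inl v, offDiagPair i j hij) =
        Quot.mk r (Sum.inr w, offDiagMap σ (offDiagPair i j hij)) := by
    intro i j hij hi
    by_cases hcase : i = e ∨ j ≠ j₀
    · exact hpair' i j hij hi hcase
    · push Not at hcase
      exact hpair i j hij hi (fun _ _ k hik hk => hpair' i k hik hi (Or.inr hk))
        (Or.inr (Or.inl hcase.2))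
  have hall : ∀ s, Quot.mk r (Sum.inl v, s) = Quot.mk r (Sum.inr w, offDiagMap σ s) := by
    intro s
    by_cases hs : s ∈ K
    · exact hK s hs
    have hmem : ∃ i ∈ s.1, (G.edge (v, i)).1 = w := by
      by_contra! hcon
      refine hs (Finset.mem_filter.mpr ⟨Finset.mem_univ _, fun hins => ?_, fun him => ?_⟩)
      · obtain ⟨i, j, hij, rfl⟩ := exists_eq_offDiagPair s
        exact hcon i (Sym2.mem_mk_left i j) (hins i (Sym2.mem_mk_left i j))
      · obtain ⟨⟨k, hk⟩, -, rfl⟩ := Finset.mem_image.mp him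
        simp only [φ] at hcon
        split_ifs at hcon with h1
        · exact hcon k (Sym2.mem_mk_left k j₀) h1
        · exact hcon e (Sym2.mem_mk_left e k) he
    obtain ⟨i, his, hi⟩ := hmem
    obtain ⟨k, l, hkl, rfl⟩ := exists_eq_offDiagPair s
    rcases Sym2.mem_iff.mp his with rfl | rfl
    · exact hpair'' i l hkl hi
    · rw [offDiagPair_comm]
      exact hpair'' i k hkl.symm hi
  -- the faces of the contraction cover all classes but those of the inner faces
  let ψ : (contract h).CornerFace → Quot r :=
    Quot.lift (fun c => Quot.mk r (contractIncl h c.1, c.2)) (by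
      rintro _ _ ⟨x, rfl, rfl⟩
      let y := StrandEnd.equivNe v x
      refine (hcons y.1).trans ?_
      change _ = Quot.mk r (Sum.inr (contractStrand h y).1.corner.1,
        (contractStrand h y).1.corner.2)
      by_cases hy : (G.strand y).1.1 = w
      · rw [contractStrand_of_eq h y hy]
        -- A merged strand runs to `w`, jumps to `v` by the identification `hall`, and continues
        -- along the next edge.
        refine Eq.trans ?_ (hcons ((G.strand y).move v σ.symm))
        refine Eq.trans ?_ (hall ((G.strand y).move v σ.symm).corner.2).symm
        refine congrArg _ (Prod.ext (congrArg Sum.inr hy) (Subtype.ext ?_))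
        change s((G.strand y).1.2.1, (G.strand y).1.2.2) =
          s(σ (σ.symm (G.strand y).1.2.1), σ (σ.symm (G.strand y).1.2.2))
        rw [Equiv.apply_symm_apply, Equiv.apply_symm_apply]
      · rw [contractStrand_of_ne h y hy]
        rfl)
  let Ψ : (contract h).CornerFace ⊕ {s // inside s} → Quot r :=
    Sum.elim ψ fun s => Quot.mk r (Sum.inl v, s.1)
  have hT : ∀ s, ∃ a, Ψ a = Quot.mk r (Sum.inl v, s) := by
    intro s
    by_cases hs : inside s
    · exact ⟨Sum.inr ⟨s, hs⟩, rfl⟩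
    -- A corner of `v` with a half-edge leading away from `w` is consecutive to a corner at a
    -- surviving `P`-vertex.
    have hout : ∀ i j (hij : i ≠ j), (G.edge (v, i)).1 ≠ w →
        ∃ a, Ψ a = Quot.mk r (Sum.inl v, offDiagPair i j hij) := by
      intro i j hij hi
      have hP : (G.strand ⟨(v, i, j), hij⟩).1.1 ≠ w := fun hc =>
        hi ((congrArg Prod.fst (G.strand_halfEdge ⟨(v, i, j), hij⟩)).symm.trans hc)
      refine ⟨Sum.inl (Quot.mk _ (Sum.inr ⟨_, hP⟩, (G.strand ⟨(v, i, j), hij⟩).corner.2)), ?_⟩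
      exact (hcons ⟨(v, i, j), hij⟩).symm
    obtain ⟨i, j, hij, rfl⟩ := exists_eq_offDiagPair s
    by_cases hi : (G.edge (v, i)).1 = w
    · by_cases hj : (G.edge (v, j)).1 = w
      · refine absurd (fun k hk => ?_) hs
        rcases Sym2.mem_iff.mp hk with rfl | rfl
        exacts [hi, hj]
      · rw [offDiagPair_comm]
        exact hout j i hij.symm hj
    · exact hout i j hij hi
  have hΨ : Function.Surjective Ψ := by
    intro q
    induction q using Quot.ind with | mk c => ?_
    obtain ⟨t | p, s⟩ := c
    · by_cases ht : t = v
      · subst ht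
        exact hT s
      · exact ⟨Sum.inl (Quot.mk _ (Sum.inl ⟨t, ht⟩, s)), rfl⟩
    · by_cases hp : p = w
      · subst hp
        have hs : offDiagMap σ (offDiagMap σ.symm s) = s := by
          apply Subtype.ext
          simp [offDiagMap, Sym2.map_map]
        obtain ⟨a, ha⟩ := hT (offDiagMap σ.symm s)
        refine ⟨a, ha.trans ?_⟩
        rw [hall, hs]
      · exact ⟨Sum.inl (Quot.mk _ (Sum.inr ⟨p, hp⟩, s)), rfl⟩
  have h1 : Nat.card G.CornerFace ≤ Nat.card (Quot r) + K.card :=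
    card_quot_le_card_quot_or_add_card _ _ _ K
  have h2 : Nat.card (Quot r) ≤ Nat.card (contract h).CornerFace + Nat.card {s // inside s} := by
    rw [← Nat.card_sum]
    exact Nat.card_le_card_of_surjective Ψ hΨ
  have h3 : Nat.card {s // inside s} = (Finset.univ.filter inside).card := by
    rw [Nat.card_eq_fintype_card, Fintype.card_subtype]
  have h4 : (Finset.univ.image φ).card = D := by
    rw [Finset.card_image_of_injective _ hφ, Finset.card_univ, Fintype.card_subtype_compl,
      Fintype.card_fin, Fintype.card_subtype_eq, Nat.add_sub_cancel]
  have hφin : ∀ s ∈ Finset.univ.image φ, ¬ inside s := by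
    intro s hs hins
    obtain ⟨⟨k, hk⟩, -, rfl⟩ := Finset.mem_image.mp hs
    simp only [φ] at hins
    split_ifs at hins with h1
    · exact hj₀ (hins j₀ (Sym2.mem_mk_right k j₀))
    · exact h1 (hins k (Sym2.mem_mk_right e k))
  have hd1 : Disjoint (Finset.univ.filter inside) (Finset.univ.image φ) :=
    Finset.disjoint_left.mpr fun s hs hs' => hφin s hs' (Finset.mem_filter.mp hs).2
  have hd2 : Disjoint K (Finset.univ.filter inside ∪ Finset.univ.image φ) := by
    refine Finset.disjoint_left.mpr fun s hs hs' => ?_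
    have hs1 := (Finset.mem_filter.mp hs).2
    rcases Finset.mem_union.mp hs' with h5 | h5
    · exact hs1.1 (Finset.mem_filter.mp h5).2
    · exact hs1.2 h5
  -- Disjointness inside the `D.choose 2 + D` corners bounds the identifications in `K` and the
  -- inner faces together by `D.choose 2`.
  have h5 := Finset.card_le_univ (K ∪ (Finset.univ.filter inside ∪ Finset.univ.image φ))
  rw [Finset.card_union_of_disjoint hd2, Finset.card_union_of_disjoint hd1, card_offDiagPairs,
    h4] at h5
  omega

end StrandedGraph

/-! ### Connectedness and degree -/

namespace StrandedGraph

variable {D : ℕ} {G : StrandedGraph D}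

theorem skeleton_adj_edge (a : G.TVertex × Fin (D + 1)) :
    G.skeleton.Adj (Sum.inl a.1) (Sum.inr (G.edge a).1) := by
  rw [skeleton, SimpleGraph.fromRel_adj]
  exact ⟨Sum.inl_ne_inr, Or.inl ⟨a, rfl, rfl⟩⟩

theorem skeleton_adj_iff (x y : G.Vertex) : G.skeleton.Adj x y ↔
    ∃ a, x = Sum.inl a.1 ∧ y = Sum.inr (G.edge a).1 ∨
      y = Sum.inl a.1 ∧ x = Sum.inr (G.edge a).1 := by
  constructor
  · intro h
    rw [skeleton, SimpleGraph.fromRel_adj] at h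
    obtain ⟨-, ⟨a, ha⟩ | ⟨a, ha⟩⟩ := h
    exacts [⟨a, Or.inl ha⟩, ⟨a, Or.inr ha⟩]
  · rintro ⟨a, ⟨rfl, rfl⟩ | ⟨rfl, rfl⟩⟩
    exacts [skeleton_adj_edge a, (skeleton_adj_edge a).symm]

theorem IsConnected.reachable (hG : G.IsConnected) (x y : G.Vertex) :
    G.skeleton.Reachable x y := by
  obtain ⟨_, -⟩ := Nat.card_eq_one_iff_unique.mp hG
  exact SimpleGraph.ConnectedComponent.exact
    (Sum.inl_injective (Subsingleton.elim (G.vertexComponent x) (G.vertexComponent y)))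

theorem IsConnected.isEmpty_ring (hG : G.IsConnected) (x : G.Vertex) : IsEmpty G.Ring := by
  obtain ⟨_, -⟩ := Nat.card_eq_one_iff_unique.mp hG
  exact ⟨fun r => Sum.inl_ne_inr (Subsingleton.elim (G.vertexComponent x) (Sum.inr r))⟩

theorem isConnected_of_reachable [IsEmpty G.Ring] (z : G.Vertex)
    (h : ∀ x, G.skeleton.Reachable x z) : G.IsConnected := by
  refine Nat.card_eq_one_iff_unique.mpr ⟨⟨fun C C' => ?_⟩, ⟨G.vertexComponent z⟩⟩
  have key : ∀ C : G.Component, C = G.vertexComponent z := by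
    rintro (C | r)
    · induction C using SimpleGraph.ConnectedComponent.ind with | _ x => ?_
      exact congrArg Sum.inl (SimpleGraph.ConnectedComponent.sound (h x))
    · exact isEmptyElim r
  rw [key C, key C']

/-- A property of vertices that is passed on along edges in both directions holds for all vertices
of a connected graph, if it holds for one. -/
theorem IsConnected.forall_vertex (hG : G.IsConnected) (Z : G.Vertex → Prop)
    (hZ : ∀ a, Z (Sum.inl a.1) ↔ Z (Sum.inr (G.edge a).1)) (x₀ : G.Vertex) (h₀ : Z x₀)
    (x : G.Vertex) : Z x := by
  have h := (SimpleGraph.reachable_iff_reflTransGen x₀ x).mp (hG.reachable x₀ x)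
  induction h with
  | refl => exact h₀
  | tail _ hadj ih =>
    obtain ⟨a, ⟨rfl, rfl⟩ | ⟨rfl, rfl⟩⟩ := (skeleton_adj_iff _ _).mp hadj
    exacts [(hZ a).mp ih, (hZ a).mpr ih]

theorem IsConnected.degree_eq (hG : G.IsConnected) :
    G.degree = D + (D : ℚ) * ((D : ℚ) - 1) / 4 * G.numVertices - (Nat.card G.Face : ℚ) := by
  obtain ⟨hs, ⟨C⟩⟩ := Nat.card_eq_one_iff_unique.mp hG
  have : Unique G.Component := ⟨⟨C⟩, fun _ => Subsingleton.elim _ _⟩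
  rw [degree, finsum_unique, componentDegree,
    Nat.card_congr (Equiv.subtypeUnivEquiv fun _ => Subsingleton.elim _ _),
    Nat.card_congr (Equiv.subtypeUnivEquiv fun _ => Subsingleton.elim _ _), numVertices]

theorem card_face_eq [IsEmpty G.Ring] : Nat.card G.Face = Nat.card G.CornerFace := by
  rw [Nat.card_sum, Nat.card_of_isEmpty (α := Σ r : G.Ring, G.RingFace r), add_zero]

section contract

variable {v : G.TVertex} {w : G.PVertex} {σ : Equiv.Perm (Fin (D + 1))}

theorem contract_adj_of_ne (h : G.Aligned v w σ) (a : G.TVertex × Fin (D + 1)) (ha : a.1 ≠ v)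
    (haw : (G.edge a).1 ≠ w) :
    (contract h).skeleton.Adj (Sum.inl ⟨a.1, ha⟩) (Sum.inr ⟨(G.edge a).1, haw⟩) := by
  have h1 : ((contract h).edge (⟨a.1, ha⟩, a.2)).1 = ⟨(G.edge a).1, haw⟩ :=
    Subtype.ext (congrArg Prod.fst (contractEdge_of_ne h ⟨a, ha⟩ haw))
  rw [← h1]
  exact skeleton_adj_edge (G := contract h) (⟨a.1, ha⟩, a.2)

theorem contract_adj_of_eq (h : G.Aligned v w σ) (a : G.TVertex × Fin (D + 1)) (ha : a.1 ≠ v)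
    (haw : (G.edge a).1 = w) :
    (contract h).skeleton.Adj (Sum.inl ⟨a.1, ha⟩)
      (Sum.inr ⟨(G.edge (v, σ.symm (G.edge a).2)).1, h.edge_ne a ha haw⟩) := by
  have h1 : ((contract h).edge (⟨a.1, ha⟩, a.2)).1 =
      ⟨(G.edge (v, σ.symm (G.edge a).2)).1, h.edge_ne a ha haw⟩ :=
    Subtype.ext (congrArg Prod.fst (contractEdge_of_eq h ⟨a, ha⟩ haw))
  rw [← h1]
  exact skeleton_adj_edge (G := contract h) (⟨a.1, ha⟩, a.2)

instance (h : G.Aligned v w σ) : IsEmpty (contract h).Ring :=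
  inferInstanceAs (IsEmpty Empty)

/-- If the neighbours of `v` other than `w` stay connected to each other, so does the whole
graph. -/
theorem isConnected_contract (hG : G.IsConnected) (h : G.Aligned v w σ) (z : (contract h).Vertex)
    (hz : ∀ i (hi : (G.edge (v, i)).1 ≠ w),
      (contract h).skeleton.Reachable (Sum.inr ⟨(G.edge (v, i)).1, hi⟩) z) :
    (contract h).IsConnected := by
  refine isConnected_of_reachable z fun y => ?_
  -- Quantifying over preimages makes the property vacuous at `v` and `w`, which do not survive.
  refine hG.forall_vertex
    (fun x => ∀ y, contractIncl h y = x → (contract h).skeleton.Reachable y z) ?_ (Sum.inl v) ?_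
    (contractIncl h y) y rfl
  · intro a
    by_cases ha : a.1 = v
    · obtain ⟨t, i⟩ := a
      obtain rfl : t = v := ha
      constructor
      · rintro - (⟨t, ht⟩ | ⟨p, hp⟩) hy
        · cases hy
        · obtain rfl : p = (G.edge (t, i)).1 := Sum.inr_injective hy
          exact hz i hp
      · rintro - (⟨t', ht⟩ | p) hy
        · exact absurd (Sum.inl_injective hy) ht
        · cases hy
    · by_cases haw : (G.edge a).1 = w
      · constructor
        · rintro - (t | ⟨p, hp⟩) hy
          · cases hy
          · exact absurd ((Sum.inr_injective hy).trans haw) hp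
        · rintro - (⟨t, ht⟩ | p) hy
          · obtain rfl : t = a.1 := Sum.inl_injective hy
            exact (contract_adj_of_eq h a ha haw).reachable.trans (hz _ _)
          · cases hy
      · have hadj := (contract_adj_of_ne h a ha haw).reachable
        constructor
        · rintro hZ (t | ⟨p, hp⟩) hy
          · cases hy
          · obtain rfl : p = (G.edge a).1 := Sum.inr_injective hy
            exact hadj.symm.trans (hZ (Sum.inl ⟨a.1, ha⟩) rfl)
        · rintro hZ (⟨t, ht⟩ | p) hy
          · obtain rfl : t = a.1 := Sum.inl_injective hy
            exact hadj.trans (hZ (Sum.inr ⟨(G.edge a).1, haw⟩) rfl)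
          · cases hy
  · rintro (⟨t, ht⟩ | p) hy
    · exact absurd (Sum.inl_injective hy) ht
    · cases hy

/-- The two deleted vertices account for `2 * (D * (D - 1) / 4) = D.choose 2`, which pays for the
lost faces; connectedness on both sides makes the constant `D` occur once in each degree. -/
theorem degree_contract_le (hG : G.IsConnected) (h : G.Aligned v w σ)
    (hG' : (contract h).IsConnected)
    (hF : Nat.card G.CornerFace ≤ Nat.card (contract h).CornerFace + D.choose 2) :
    (contract h).degree ≤ G.degree := by
  have := hG.isEmpty_ring (Sum.inl v)
  rw [hG.degree_eq, hG'.degree_eq, card_face_eq, card_face_eq, ← numVertices_contract h]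
  have h1 : (Nat.card G.CornerFace : ℚ) ≤ Nat.card (contract h).CornerFace + D.choose 2 := by
    exact_mod_cast hF
  rw [Nat.cast_choose_two] at h1
  push_cast
  linarith

end contract

/-! ### Exchanging the two types of vertices -/

section dual

variable (G)

/-- The graph with the two kinds of vertices exchanged. -/
def dual : StrandedGraph D where
  TVertex := G.PVertex
  PVertex := G.TVertex
  Ring := G.Ring
  edge := G.edge.symm
  strand := G.strand.symm
  strand_halfEdge := G.halfEdge_strand_symm
  ringPerm := G.ringPerm

/-- The vertices of the dual are those of the graph. -/
def dualVertex : G.dual.Vertex ≃ G.Vertex := Equiv.sumComm _ _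

/-- The corners of the dual are those of the graph. -/
def dualCorner : G.dual.Corner ≃ G.Corner := Equiv.prodCongr G.dualVertex (Equiv.refl _)

theorem consecutive_dual (c c' : G.dual.Corner) :
    G.dual.Consecutive c c' ↔ G.Consecutive (G.dualCorner c') (G.dualCorner c) := by
  constructor
  · rintro ⟨y, rfl, rfl⟩
    exact ⟨G.strand.symm y, rfl, congrArg
      (fun z : StrandEnd D G.PVertex => ((Sum.inr z.corner.1, z.corner.2) : G.Corner))
      (G.strand.apply_symm_apply y).symm⟩
  · rintro ⟨x, h1, h2⟩
    refine ⟨G.strand x, G.dualCorner.injective (h2.trans rfl), G.dualCorner.injective (h1.trans ?_)⟩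
    change _ = (Sum.inl (G.strand.symm (G.strand x)).corner.1, _)
    change _ = (_, (G.strand.symm (G.strand x)).corner.2)
    rw [Equiv.symm_apply_apply]
    rfl

/-- The faces of the dual are those of the graph. -/
def dualFace : G.dual.CornerFace ≃ G.CornerFace where
  toFun := Quot.lift (fun c => Quot.mk _ (G.dualCorner c)) fun c c' h =>
    (Quot.sound ((G.consecutive_dual c c').mp h)).symm
  invFun := Quot.lift (fun c => Quot.mk _ (G.dualCorner.symm c)) fun c c' h =>
    (Quot.sound ((G.consecutive_dual _ _).mpr (by simpa using h))).symm
  left_inv φ := by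
    induction φ using Quot.ind
    simp
  right_inv φ := by
    induction φ using Quot.ind
    simp

theorem length_dual (c : G.dual.Corner) :
    G.dual.length (Quot.mk _ c) = G.length (Quot.mk _ (G.dualCorner c)) :=
  Nat.card_congr (G.dualCorner.subtypeEquiv fun c' =>
    (G.dualFace.apply_eq_iff_eq (x := Quot.mk _ c') (y := Quot.mk _ c)).symm)

theorem shortCorners_dual (x : G.dual.Vertex) :
    G.dual.shortCorners x = G.shortCorners (G.dualVertex x) :=
  Nat.card_congr (G.dualCorner.subtypeEquiv fun c => by
    rw [length_dual]
    exact and_congr_left fun _ => (G.dualVertex.apply_eq_iff_eq (x := c.1) (y := x)).symm)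

theorem numVertices_dual : G.dual.numVertices = G.numVertices :=
  Nat.card_congr G.dualVertex

/-- The skeletons of a graph and its dual are isomorphic. -/
def dualSkeleton : G.dual.skeleton ≃g G.skeleton where
  toEquiv := G.dualVertex
  map_rel_iff' := by
    intro x y
    rw [skeleton_adj_iff, skeleton_adj_iff]
    constructor
    · rintro ⟨a, ⟨h1, h2⟩ | ⟨h1, h2⟩⟩
      · refine ⟨G.edge a, Or.inr ⟨G.dualVertex.injective h2, G.dualVertex.injective (h1.trans ?_)⟩⟩
        change _ = Sum.inl (G.edge.symm (G.edge a)).1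
        rw [Equiv.symm_apply_apply]
      · refine ⟨G.edge a, Or.inl ⟨G.dualVertex.injective h2, G.dualVertex.injective (h1.trans ?_)⟩⟩
        change _ = Sum.inl (G.edge.symm (G.edge a)).1
        rw [Equiv.symm_apply_apply]
    · rintro ⟨a, ⟨rfl, rfl⟩ | ⟨rfl, rfl⟩⟩
      · exact ⟨G.edge.symm a, Or.inr ⟨rfl, congrArg
          (fun b : G.PVertex × Fin (D + 1) => (Sum.inr b.1 : G.Vertex))
          (G.edge.apply_symm_apply a).symm⟩⟩
      · exact ⟨G.edge.symm a, Or.inl ⟨rfl, congrArg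
          (fun b : G.PVertex × Fin (D + 1) => (Sum.inr b.1 : G.Vertex))
          (G.edge.apply_symm_apply a).symm⟩⟩

variable {G}

theorem IsConnected.dual (hG : G.IsConnected) : G.dual.IsConnected :=
  (Nat.card_congr (Equiv.sumCongr G.dualSkeleton.connectedComponentEquiv (Equiv.refl _))).trans hG

theorem IsConnected.degree_dual (hG : G.IsConnected) : G.dual.degree = G.degree := by
  have h : Nat.card G.dual.Face = Nat.card G.Face :=
    Nat.card_congr (Equiv.sumCongr G.dualFace (Equiv.refl (Σ r : G.Ring, G.RingFace r)))
  rw [hG.dual.degree_eq, hG.degree_eq, numVertices_dual, h]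

end dual

end StrandedGraph

/-! ### Faces of length two and the choice of the contraction -/

namespace StrandedGraph

variable {D : ℕ} {G : StrandedGraph D}

/-- The face through a corner of length two consists of two strands along two edges with the same
ends. -/
theorem strand_of_length_eq_two (x : StrandEnd D G.TVertex)
    (hx : G.length (Quot.mk _ (G.cornerT x)) = 2) :
    (G.edge (x.1.1, x.1.2.2)).1 = (G.edge (x.1.1, x.1.2.1)).1 ∧
      (G.strand x).1 = ((G.edge (x.1.1, x.1.2.1)).1, (G.edge (x.1.1, x.1.2.1)).2,
        (G.edge (x.1.1, x.1.2.2)).2) := by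
  obtain ⟨⟨v, i, j⟩, hij⟩ := x
  let x : StrandEnd D G.TVertex := ⟨(v, i, j), hij⟩
  let y : StrandEnd D G.TVertex := ⟨(v, j, i), fun h => hij h.symm⟩
  have hxy : G.cornerT y = G.cornerT x :=
    Prod.ext rfl (Subtype.ext Sym2.eq_swap)
  have hPx : Quot.mk G.Consecutive (G.cornerP x) = Quot.mk _ (G.cornerT x) :=
    (Quot.sound ⟨x, rfl, rfl⟩).symm
  have hPy : Quot.mk G.Consecutive (G.cornerP y) = Quot.mk _ (G.cornerT x) := by
    rw [← hxy]
    exact (Quot.sound ⟨y, rfl, rfl⟩).symm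
  -- The face contains a `T`-corner and the `P`-corners reached from its two strand ends; having
  -- only two corners, it forces these `P`-corners to coincide.
  have heq : G.cornerP x = G.cornerP y := by
    obtain ⟨c, c', -, hcc⟩ := Nat.card_eq_two_iff.mp hx
    have hmem : ∀ b : {b : G.Corner // Quot.mk G.Consecutive b = Quot.mk _ (G.cornerT x)},
        b = c ∨ b = c' := by
      intro b
      have : b ∈ ({c, c'} : Set _) := hcc ▸ Set.mem_univ b
      simpa using this
    have hne : ∀ z : StrandEnd D G.TVertex, G.cornerT x ≠ G.cornerP z := fun z h =>
      Sum.inl_ne_inr (congrArg Prod.fst h)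
    rcases hmem ⟨_, rfl⟩ with h0 | h0 <;> rcases hmem ⟨_, hPx⟩ with h1 | h1 <;>
      rcases hmem ⟨_, hPy⟩ with h2 | h2
    · exact absurd (congrArg Subtype.val (h0.trans h1.symm)) (hne x)
    · exact absurd (congrArg Subtype.val (h0.trans h1.symm)) (hne x)
    · exact absurd (congrArg Subtype.val (h0.trans h2.symm)) (hne y)
    · exact congrArg Subtype.val (h1.trans h2.symm)
    · exact congrArg Subtype.val (h1.trans h2.symm)
    · exact absurd (congrArg Subtype.val (h0.trans h2.symm)) (hne y)
    · exact absurd (congrArg Subtype.val (h0.trans h1.symm)) (hne x)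
    · exact absurd (congrArg Subtype.val (h0.trans h1.symm)) (hne x)
  have hx1 : (G.strand x).halfEdge = G.edge (v, i) := G.strand_halfEdge x
  have hy1 : (G.strand y).halfEdge = G.edge (v, j) := G.strand_halfEdge y
  have h1 : (G.strand x).1.1 = (G.strand y).1.1 := Sum.inr_injective (congrArg Prod.fst heq)
  have h2 : s((G.strand x).1.2.1, (G.strand x).1.2.2) =
      s((G.strand y).1.2.1, (G.strand y).1.2.2) :=
    congrArg Subtype.val (congrArg Prod.snd heq)
  -- The two strands arrive on different half-edges, so the equal unordered pairs are matched
  -- crosswise.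
  have h3 : (G.strand x).1.2.1 ≠ (G.strand y).1.2.1 := by
    intro h
    have h4 : G.edge (v, i) = G.edge (v, j) := by
      rw [← hx1, ← hy1]
      exact Prod.ext h1 h
    exact hij (congrArg Prod.snd (G.edge.injective h4))
  have h4 : (G.strand x).1.2.2 = (G.strand y).1.2.1 := by
    rcases Sym2.eq_iff.mp h2 with h | h
    exacts [absurd h.1 h3, h.2]
  have hx2 : (G.strand x).1.1 = (G.edge (v, i)).1 := congrArg Prod.fst hx1
  have hx3 : (G.strand x).1.2.1 = (G.edge (v, i)).2 := congrArg Prod.snd hx1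
  have hy2 : (G.strand y).1.1 = (G.edge (v, j)).1 := congrArg Prod.fst hy1
  have hy3 : (G.strand y).1.2.1 = (G.edge (v, j)).2 := congrArg Prod.snd hy1
  exact ⟨hy2.symm.trans (h1.symm.trans hx2),
    Prod.ext hx2 (Prod.ext hx3 (h4.trans hy3))⟩

/-- The graph on the half-edges of a `T`-vertex of the pairs whose corner is not on a face of
length two. -/
def longPairs (G : StrandedGraph D) (v : G.TVertex) : SimpleGraph (Fin (D + 1)) where
  Adj i j := ∃ h : i ≠ j, G.length (Quot.mk _ (Sum.inl v, offDiagPair i j h)) ≠ 2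
  symm := ⟨fun i j ⟨h, hl⟩ => ⟨h.symm, by rwa [offDiagPair_comm]⟩⟩
  loopless := ⟨fun _ ⟨h, _⟩ => h rfl⟩

theorem longPairs_adj_of_ne (v : G.TVertex) (i j : Fin (D + 1))
    (h : (G.edge (v, i)).1 ≠ (G.edge (v, j)).1) : (G.longPairs v).Adj i j := by
  have hij : i ≠ j := fun hij => h (by rw [hij])
  exact ⟨hij, fun hl => h (strand_of_length_eq_two ⟨(v, i, j), hij⟩ hl).1.symm⟩

open Classical in
theorem card_longPairs_add_shortCorners_le (v : G.TVertex) :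
    (G.longPairs v).edgeFinset.card + G.shortCorners (Sum.inl v) ≤ D.choose 2 + D := by
  let p : {s : Sym2 (Fin (D + 1)) // ¬ s.IsDiag} → Prop :=
    fun s => G.length (Quot.mk _ (Sum.inl v, s)) = 2
  have h1 : G.shortCorners (Sum.inl v) = (Finset.univ.filter p).card := by
    rw [← Fintype.card_subtype, ← Nat.card_eq_fintype_card]
    exact Nat.card_congr
      { toFun c := ⟨c.1.2, by
          have h := c.2.2
          rwa [← Prod.mk.eta (p := c.1), c.2.1] at h⟩
        invFun s := ⟨(Sum.inl v, s.1), rfl, s.2⟩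
        left_inv c := Subtype.ext (Prod.ext c.2.1.symm rfl)
        right_inv _ := rfl }
  have h2 : (G.longPairs v).edgeFinset ⊆
      (Finset.univ.filter fun s => ¬ p s).image Subtype.val := by
    intro s hs
    rw [SimpleGraph.mem_edgeFinset] at hs
    induction s with | _ i j =>
    obtain ⟨hij, hl⟩ := hs
    exact Finset.mem_image.mpr
      ⟨offDiagPair i j hij, Finset.mem_filter.mpr ⟨Finset.mem_univ _, hl⟩, rfl⟩
  have h3 := (Finset.card_le_card h2).trans Finset.card_image_le
  have h4 := Finset.card_filter_add_card_filter_not (s := Finset.univ) p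
  rw [Finset.card_univ, card_offDiagPairs] at h4
  omega

/-- The contraction along the edge `e`: how half-edges are to be merged. -/
theorem exists_aligned (v : G.TVertex) (w : G.PVertex) (e : Fin (D + 1))
    (he : (G.edge (v, e)).1 = w)
    (hshort : ∀ x : StrandEnd D G.TVertex, x.1.1 = v → (G.edge (v, x.1.2.1)).1 = w →
      (G.edge (v, x.1.2.2)).1 = w →
      (G.strand x).1 = (w, (G.edge (v, x.1.2.1)).2, (G.edge (v, x.1.2.2)).2)) :
    ∃ σ, G.Aligned v w σ ∧
      (∀ x : StrandEnd D G.TVertex, x.1.1 = v → x.1.2.1 = e → G.strand x = x.move w σ) ∧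
      (∀ x : StrandEnd D G.TVertex, x.1.1 = v → (G.edge (v, x.1.2.1)).1 = w →
        (G.edge (v, x.1.2.2)).1 = w → G.strand x = x.move w σ) := by
  classical
  -- No strand runs from `e` to itself; there the value is the half-edge of `w` at which `e` ends.
  let σ₀ : Fin (D + 1) → Fin (D + 1) := fun i =>
    if h : e ≠ i then (G.strand ⟨(v, e, i), h⟩).1.2.2 else (G.edge (v, e)).2
  have hhalf : ∀ i (h : e ≠ i), (G.strand ⟨(v, e, i), h⟩).halfEdge = G.edge (v, e) :=
    fun i h => G.strand_halfEdge ⟨(v, e, i), h⟩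
  have hσe : σ₀ e = (G.edge (v, e)).2 := by simp [σ₀]
  have hσi : ∀ i (h : e ≠ i), σ₀ i = (G.strand ⟨(v, e, i), h⟩).1.2.2 := by
    intro i h
    simp [σ₀, h]
  have hne : ∀ i, e ≠ i → σ₀ i ≠ (G.edge (v, e)).2 := by
    intro i h hc
    rw [hσi i h, ← hhalf i h] at hc
    exact (G.strand ⟨(v, e, i), h⟩).2 hc.symm
  have hσ₀ : Function.Injective σ₀ := by
    intro i j hij
    by_cases hi : e = i
    · by_cases hj : e = j
      · exact hi.symm.trans hj
      · subst hi
        exact absurd (hij.symm.trans hσe) (hne j hj)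
    · by_cases hj : e = j
      · subst hj
        exact absurd (hij.trans hσe) (hne i hi)
      · rw [hσi i hi, hσi j hj] at hij
        have h3 := (hhalf i hi).trans (hhalf j hj).symm
        have h2 : G.strand ⟨(v, e, i), hi⟩ = G.strand ⟨(v, e, j), hj⟩ :=
          Subtype.ext (Prod.ext (congrArg Prod.fst h3 :)
            (Prod.ext (congrArg Prod.snd h3 :) hij))
        have h4 := congrArg Subtype.val (G.strand.injective h2)
        exact (congrArg (fun y => y.2.2) h4 :)
  let σ : Equiv.Perm (Fin (D + 1)) := Equiv.ofBijective σ₀ hσ₀.bijective_of_finite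
  have hσ : G.Aligned v w σ := by
    intro i hi
    by_cases hei : e = i
    · subst hei
      exact hσe.symm
    · change _ = σ₀ i
      rw [hσi i hei, hshort ⟨(v, e, i), hei⟩ rfl he hi]
  refine ⟨σ, hσ, ?_, ?_⟩
  · rintro ⟨⟨t, i, j⟩, hij⟩ ht hi
    obtain rfl : t = v := ht
    obtain rfl : i = e := hi
    have h1 := hhalf j hij
    refine Subtype.ext (Prod.ext ?_ (Prod.ext ?_ ?_))
    · exact (congrArg Prod.fst h1).trans he
    · exact (congrArg Prod.snd h1).trans hσe.symm
    · exact (hσi j hij).symm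
  · intro x hx hi hj
    apply Subtype.ext
    rw [hshort x hx hi hj, hσ _ hi, hσ _ hj]
    rfl

/-- A connected graph in which all edges of a vertex go to the same vertex has only two
vertices. -/
theorem exists_edge_ne (hG : G.IsConnected) (hV : 2 < G.numVertices) (v : G.TVertex)
    (w : G.PVertex) : ∃ i, (G.edge (v, i)).1 ≠ w := by
  by_contra! hcon
  have hinj : Function.Injective fun i => (G.edge (v, i)).2 := by
    intro i j hij
    have h : G.edge (v, i) = G.edge (v, j) := Prod.ext ((hcon i).trans (hcon j).symm) hij
    exact congrArg Prod.snd (G.edge.injective h)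
  have hsurj := Finite.surjective_of_injective hinj
  -- The edges of `v` use up all half-edges of `w`, so `{v, w}` is closed under adjacency.
  have hall : ∀ x : G.Vertex, x = Sum.inl v ∨ x = Sum.inr w := by
    refine hG.forall_vertex _ (fun a => ?_) (Sum.inl v) (Or.inl rfl)
    simp only [Sum.inl.injEq, Sum.inr.injEq, reduceCtorEq, or_false, false_or]
    constructor
    · intro ha
      rw [show a = (v, a.2) from Prod.ext ha rfl]
      exact hcon a.2
    · intro ha
      obtain ⟨i, hi⟩ := hsurj (G.edge a).2
      have h : G.edge (v, i) = G.edge a := Prod.ext ((hcon i).trans ha.symm) hi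
      rw [← G.edge.injective h]
  have hsur : Function.Surjective
      (fun b : Bool => if b then (Sum.inl v : G.Vertex) else Sum.inr w) := by
    intro x
    rcases hall x with rfl | rfl
    exacts [⟨true, rfl⟩, ⟨false, rfl⟩]
  have := Nat.card_le_card_of_surjective _ hsur
  rw [Nat.card_eq_fintype_card (α := Bool), Fintype.card_bool] at this
  exact absurd hV this.not_gt

/-- A set of vertices cannot be joined to the rest of the graph by edges from its `P`-vertices to
one `T`-vertex only, if these are neither none nor all edges of that vertex. -/
theorem exists_edge_leaving (v : G.TVertex) (X : G.Vertex → Prop) (hv : ¬ X (Sum.inl v))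
    {i j : Fin (D + 1)} (hi : X (Sum.inr (G.edge (v, i)).1))
    (hj : ¬ X (Sum.inr (G.edge (v, j)).1)) :
    ∃ a, a.1 ≠ v ∧ ¬ (X (Sum.inl a.1) ↔ X (Sum.inr (G.edge a).1)) := by
  classical
  by_contra! hcon
  -- The edges ending at `P`-vertices of `X` start at `T`-vertices of `X` or at `v`. Both sets of
  -- half-edges in `X` have size divisible by `D + 1`, hence so has the number of edges from `v`
  -- into `X`, which lies strictly between `0` and `D + 1`.
  have e1 : {a : G.TVertex × Fin (D + 1) // X (Sum.inl a.1)} ⊕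
      {k : Fin (D + 1) // X (Sum.inr (G.edge (v, k)).1)} ≃
      {b : G.PVertex × Fin (D + 1) // X (Sum.inr b.1)} := by
    refine Equiv.ofBijective (Sum.elim
      (fun a => ⟨G.edge a.1, (hcon a.1 fun h => hv (h ▸ a.2)).mp a.2⟩)
      (fun k => ⟨G.edge (v, k), k.2⟩)) ⟨?_, ?_⟩
    · rintro (⟨a, ha⟩ | ⟨k, hk⟩) (⟨b, hb⟩ | ⟨l, hl⟩) hab
      · have := G.edge.injective (congrArg Subtype.val hab)
        subst this
        rfl
      · have := G.edge.injective (congrArg Subtype.val hab)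
        subst this
        exact absurd ha hv
      · have := G.edge.injective (congrArg Subtype.val hab)
        subst this
        exact absurd hb hv
      · have := congrArg Prod.snd (G.edge.injective (congrArg Subtype.val hab))
        obtain rfl : k = l := this
        rfl
    · rintro ⟨b, hb⟩
      by_cases h : (G.edge.symm b).1 = v
      · have h1 : (v, (G.edge.symm b).2) = G.edge.symm b := Prod.ext h.symm rfl
        have h2 : G.edge (v, (G.edge.symm b).2) = b := by rw [h1, Equiv.apply_symm_apply]
        exact ⟨Sum.inr ⟨(G.edge.symm b).2, by rw [h2]; exact hb⟩, Subtype.ext h2⟩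
      · refine ⟨Sum.inl ⟨G.edge.symm b, (hcon _ h).mpr ?_⟩, Subtype.ext ?_⟩
        · rw [Equiv.apply_symm_apply]
          exact hb
        · exact G.edge.apply_symm_apply b
  have e2 : ∀ (U : Type) (Y : U → Prop), {a : U × Fin (D + 1) // Y a.1} ≃
      {u : U // Y u} × Fin (D + 1) := fun U Y =>
    { toFun a := (⟨a.1.1, a.2⟩, a.1.2)
      invFun a := ⟨(a.1.1, a.2), a.1.2⟩
      left_inv _ := rfl
      right_inv _ := rfl }
  have h1 := Nat.card_congr e1
  rw [Nat.card_sum, Nat.card_congr (e2 G.TVertex fun t => X (Sum.inl t)),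
    Nat.card_congr (e2 G.PVertex fun p => X (Sum.inr p)), Nat.card_prod, Nat.card_prod,
    Nat.card_fin] at h1
  have h2 : 0 < Nat.card {k : Fin (D + 1) // X (Sum.inr (G.edge (v, k)).1)} :=
    Nat.card_pos_iff.mpr ⟨⟨⟨i, hi⟩⟩, inferInstance⟩
  have h3 : Nat.card {k : Fin (D + 1) // X (Sum.inr (G.edge (v, k)).1)} < D + 1 := by
    rw [Nat.card_eq_fintype_card]
    simpa using Fintype.card_subtype_lt
      (p := fun k : Fin (D + 1) => X (Sum.inr (G.edge (v, k)).1)) hj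
  have h4 : D + 1 ∣ Nat.card {k : Fin (D + 1) // X (Sum.inr (G.edge (v, k)).1)} :=
    (Nat.dvd_add_right (dvd_mul_left _ _)).mp (h1 ▸ dvd_mul_left _ _)
  exact absurd (Nat.le_of_dvd h2 h4) (by omega)

/-- Contraction of a `T`-vertex and one of its neighbours lowers the number of vertices and does not
raise the degree, if the edges between them form faces of length two and the other neighbours of the
`T`-vertex stay connected. -/
theorem exists_contraction (hG : G.IsConnected) (v : G.TVertex) (w : G.PVertex)
    {e j : Fin (D + 1)} (he : (G.edge (v, e)).1 = w) (hj : (G.edge (v, j)).1 ≠ w)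
    (hshort : ∀ x : StrandEnd D G.TVertex, x.1.1 = v → (G.edge (v, x.1.2.1)).1 = w →
      (G.edge (v, x.1.2.2)).1 = w →
      (G.strand x).1 = (w, (G.edge (v, x.1.2.1)).2, (G.edge (v, x.1.2.2)).2))
    (hconn : ∀ i, (G.edge (v, i)).1 ≠ w → ∀ (Z : G.Vertex → Prop),
      (∀ a, a.1 ≠ v → (G.edge a).1 ≠ w → (Z (Sum.inl a.1) ↔ Z (Sum.inr (G.edge a).1))) →
      Z (Sum.inr (G.edge (v, j)).1) → Z (Sum.inr (G.edge (v, i)).1)) :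
    ∃ G' : StrandedGraph D, Nonempty G'.Component ∧
      G'.numVertices < G.numVertices ∧ G'.degree ≤ G.degree := by
  obtain ⟨σ, hσ, h1, h2⟩ := exists_aligned v w e he hshort
  have hG' : (contract hσ).IsConnected := by
    refine isConnected_contract hG hσ (Sum.inr ⟨(G.edge (v, j)).1, hj⟩) fun i hi => ?_
    -- `hconn` expresses connectedness in `G` without `v` and `w` through closed properties; here
    -- the property is reachability in the contraction.
    refine hconn i hi (fun x => ∀ y, contractIncl hσ y = x → (contract hσ).skeleton.Reachable y
      (Sum.inr ⟨(G.edge (v, j)).1, hj⟩)) ?_ ?_ (Sum.inr ⟨_, hi⟩) rfl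
    · intro a ha haw
      have hadj := (contract_adj_of_ne hσ a ha haw).reachable
      constructor
      · rintro hZ (t | ⟨p, hp⟩) hy
        · cases hy
        · obtain rfl : p = (G.edge a).1 := Sum.inr_injective hy
          exact hadj.symm.trans (hZ (Sum.inl ⟨a.1, ha⟩) rfl)
      · rintro hZ (⟨t, ht⟩ | p) hy
        · obtain rfl : t = a.1 := Sum.inl_injective hy
          exact hadj.trans (hZ (Sum.inr ⟨(G.edge a).1, haw⟩) rfl)
        · cases hy
    · rintro (t | ⟨p, hp⟩) hy
      · cases hy
      · obtain rfl : p = (G.edge (v, j)).1 := Sum.inr_injective hy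
        exact SimpleGraph.Reachable.refl _
  refine ⟨contract hσ, ?_, ?_, ?_⟩
  · exact (Nat.card_eq_one_iff_unique.mp hG').2
  · have := numVertices_contract hσ
    omega
  · exact degree_contract_le hG hσ hG' (card_cornerFace_le_card_contract hσ he hj h1 h2)

/-- Half-edges of `v` are coloured by the neighbour they lead to. Few long pairs leave either two
colours, one without long pairs inside, or two single edges beside one dominant colour. -/
theorem exists_smaller_of_tVertex (hD : 3 ≤ D) (hG : G.IsConnected) (hV : 2 < G.numVertices)
    (v : G.TVertex) (hv : (D - 1).choose 2 ≤ G.shortCorners (Sum.inl v)) :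
    ∃ G' : StrandedGraph D, Nonempty G'.Component ∧
      G'.numVertices < G.numVertices ∧ G'.degree ≤ G.degree := by
  classical
  -- `(D + 1).choose 2 - (D - 1).choose 2 = 2 * D - 1`.
  have hE : (G.longPairs v).edgeFinset.card < 2 * D := by
    have h1 := card_longPairs_add_shortCorners_le v
    obtain ⟨d, rfl⟩ : ∃ d, D = d + 1 := ⟨D - 1, by omega⟩
    rw [Nat.choose_succ_succ' d 1, Nat.choose_one_right] at h1
    rw [Nat.add_sub_cancel] at hv
    simp only [Nat.reduceAdd] at h1
    omega
  have hcard : Fintype.card (Fin (D + 1)) = D + 1 := Fintype.card_fin _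
  let ν : Fin (D + 1) → G.PVertex := fun i => (G.edge (v, i)).1
  have hν : ∀ i j, ν i ≠ ν j → (G.longPairs v).Adj i j := longPairs_adj_of_ne v
  have hshort : ∀ w, (∀ i j, ν i = w → ν j = w → ¬ (G.longPairs v).Adj i j) →
      ∀ x : StrandEnd D G.TVertex, x.1.1 = v → (G.edge (v, x.1.2.1)).1 = w →
      (G.edge (v, x.1.2.2)).1 = w →
      (G.strand x).1 = (w, (G.edge (v, x.1.2.1)).2, (G.edge (v, x.1.2.2)).2) := by
    rintro w hw x rfl hi hj
    have h1 : G.length (Quot.mk _ (G.cornerT x)) = 2 := by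
      by_contra hl
      exact hw _ _ hi hj ⟨x.2, hl⟩
    rw [(strand_of_length_eq_two x h1).2, hi]
  obtain ⟨q, hpq⟩ := exists_edge_ne hG hV v (ν 0)
  by_cases h3 : ∃ r, ν r ≠ ν 0 ∧ ν r ≠ ν q
  · obtain ⟨r, hr0, hrq⟩ := h3
    obtain ⟨a, b, c, hab, hac, hbc, hc⟩ := SimpleGraph.exists_pair_of_three_classes
      (G.longPairs v) hcard hE ν hν (p := 0) (q := q) (r := r) (Ne.symm hpq) hr0.symm hrq.symm
    have key : ∀ a b, ν a ≠ ν b → ν a ≠ ν c → ν b ≠ ν c →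
        (∀ k, k ≠ a → k ≠ b → ν k = ν c) →
        (∀ (Z : G.Vertex → Prop), (∀ x, x.1 ≠ v → (G.edge x).1 ≠ ν a →
          (Z (Sum.inl x.1) ↔ Z (Sum.inr (G.edge x).1))) →
          Z (Sum.inr (ν c)) → Z (Sum.inr (ν b))) →
        ∃ G' : StrandedGraph D, Nonempty G'.Component ∧
          G'.numVertices < G.numVertices ∧ G'.degree ≤ G.degree := by
      intro a b hab hac hbc hc hZ
      -- A single edge joins `v` to `ν a`, so the condition on short faces is vacuous for this
      -- contraction.
      have huniq : ∀ k, ν k = ν a → k = a := by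
        intro k hk
        by_contra hka
        by_cases hkb : k = b
        · exact hab (by rw [← hk, hkb])
        · exact hac (hk.symm.trans (hc k hka hkb))
      refine exists_contraction hG v (ν a) (e := a) (j := c) rfl hac.symm ?_ ?_
      · rintro x rfl hi hj
        exact absurd ((huniq _ hi).trans (huniq _ hj).symm) x.2
      · intro i hi Z hZ1 hZ2
        by_cases hib : i = b
        · rw [hib]
          exact hZ Z hZ1 hZ2
        · have : ν i = ν c := hc i (fun h => hi (by rw [h])) hib
          change Z (Sum.inr (ν i))
          rw [this]
          exact hZ2
    -- If both contractions fail, `Z` separates `ν c` from `ν b` away from `v` and `ν a`, and `Z'`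
    -- separates `ν c` from `ν a` away from `v` and `ν b`.
    by_contra hno
    have hna : ¬ _ := fun hZ => hno (key a b hab hac hbc hc hZ)
    have hnb : ¬ _ := fun hZ => hno (key b a hab.symm hbc hac (fun k hk hk' => hc k hk' hk) hZ)
    push Not at hna hnb
    obtain ⟨Z, hZ, hZc, hZb⟩ := hna
    obtain ⟨Z', hZ', hZc', hZa⟩ := hnb
    -- the common part of the two separating sets is joined to `v` only
    obtain ⟨x, hxv, hx⟩ := exists_edge_leaving v
      (fun x => x ≠ Sum.inl v ∧ x ≠ Sum.inr (ν a) ∧ x ≠ Sum.inr (ν b) ∧ Z x ∧ Z' x)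
      (fun h => h.1 rfl) (i := c) (j := a)
      ⟨Sum.inr_ne_inl, fun h => hac (Sum.inr_injective h).symm,
        fun h => hbc (Sum.inr_injective h).symm, hZc, hZc'⟩ (fun h => h.2.1 rfl)
    have hZx := hZ x hxv
    have hZx' := hZ' x hxv
    have hxv' : (Sum.inl x.1 : G.Vertex) ≠ Sum.inl v := fun h => hxv (Sum.inl_injective h)
    -- `Z'` is respected by edges to `ν a` and fails there, so no such edge starts in the common
    -- part; likewise with `Z` at `ν b`.
    by_cases hxa : (G.edge x).1 = ν a
    · have := hZx' (by rw [hxa]; exact hab)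
      rw [hxa] at hx this
      simp only [ne_eq, reduceCtorEq, not_false_eq_true, true_and, hxv', not_true,
        false_and, iff_false] at hx
      tauto
    by_cases hxb : (G.edge x).1 = ν b
    · have := hZx (by rw [hxb]; exact hab.symm)
      rw [hxb] at hx this
      simp only [ne_eq, reduceCtorEq, not_false_eq_true, true_and, hxv', not_true,
        false_and, and_false, iff_false] at hx
      tauto
    · have h1 := hZx hxa
      have h2 := hZx' hxb
      have h3 : (Sum.inr (G.edge x).1 : G.Vertex) ≠ Sum.inr (ν a) :=
        fun h => hxa (Sum.inr_injective h)
      have h4 : (Sum.inr (G.edge x).1 : G.Vertex) ≠ Sum.inr (ν b) :=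
        fun h => hxb (Sum.inr_injective h)
      simp only [ne_eq, reduceCtorEq, not_false_eq_true, true_and, hxv', h3, h4, h1, h2] at hx
      exact hx trivial
  · push Not at h3
    have hcov : ∀ k, ν k = ν 0 ∨ ν k = ν q := fun k => or_iff_not_imp_left.mpr (h3 k)
    rcases SimpleGraph.exists_independent_of_two_classes (G.longPairs v) hcard hE ν
      (Ne.symm hpq) hν hcov with h | h
    · refine exists_contraction hG v (ν 0) (e := 0) (j := q) rfl hpq (hshort _ h) ?_
      intro i hi Z _ hZ
      have : (G.edge (v, i)).1 = (G.edge (v, q)).1 := (hcov i).resolve_left hi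
      rw [this]
      exact hZ
    · refine exists_contraction hG v (ν q) (e := q) (j := 0) rfl (Ne.symm hpq) (hshort _ h) ?_
      intro i hi Z _ hZ
      have : (G.edge (v, i)).1 = (G.edge (v, 0)).1 := (hcov i).resolve_right hi
      rw [this]
      exact hZ

end StrandedGraph

theorem mainTheorem3 (D : ℕ) (hD : 3 ≤ D) (G : StrandedGraph D) (hconn : G.IsConnected)
    (hV : 2 < G.numVertices) (v : G.Vertex) (hv : (D - 1).choose 2 ≤ G.shortCorners v) :
    ∃ G' : StrandedGraph D, Nonempty G'.Component ∧
      G'.numVertices < G.numVertices ∧ G'.degree ≤ G.degree := by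
  obtain v | v := v
  · exact StrandedGraph.exists_smaller_of_tVertex hD hconn hV v hv
  · rw [← G.numVertices_dual, ← hconn.degree_dual]
    refine StrandedGraph.exists_smaller_of_tVertex hD hconn.dual ?_ v ?_
    · rwa [G.numVertices_dual]
    · rw [StrandedGraph.shortCorners_dual]
      exact hv
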